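/- Let $f:2^U\to\mathbb{R}_{\ge 0}$ be a non-negative monotone submodular function on a finite set $U$ with $|U|=n$, let $\mathcal M=(U,\mathcal F)$ be a matroid, let each $u\in U$ have a size $c_u\ge 0$, and let $B\ge 0$. Write $c(S)=\sum_{u\in S}c_u$, and call $S\subseteq U$ feasible if $S\in\mathcal F$ and $c(S)\le B$. The problem is to find a feasible $S$ maximizing $f(S)$. For an independent set $S$, a swap is a pair $(x,y)$ with $x\in U\setminus S$ and $y\in S\cup\{\phi\}$, where $\phi$ is a dummy element, such that $S'=(S\setminus\{y\})\cup\{x\}\in\mathcal F$. Its density is $(f(S')-f(S))/c_x$, read as $+\infty$ if $c_x=0$ and $f(S')>f(S)$, and as $0$ if $c_x=0$ and $f(S')\le f(S)$. For $\varepsilon>0$, the modified algorithm 1-MatKnap works as follows. For every feasible set $Y=\{u_1,u_2\}$ of two elements (a guess of the first two elements of an optimal solution) it starts with $S=Y$. As long as possible it replaces $S$ by $S'=(S\setminus\{y\})\cup\{x\}$, where $(x,y)$ is a swap of maximum density (ties broken arbitrarily) among those with $y\notin Y$, positive density, $c(S')\le B$ and, if $y\ne\phi$, $f(S')\ge(1+\varepsilon/n^2)\,f(S)$.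 It stops working on $Y$ when no such swap exists, or as soon as $f(S)>\frac n2 f(Y)$ (in which case $Y$ cannot be the right guess). The output is a set of largest value among the final sets $S$ for all guesses $Y$ and the feasible sets with at most one element. Theorem. There is a constant $\varepsilon>0$ such that every possible output of the modified algorithm is a $\frac{1-e^{-2}}2$-approximation, that is, a feasible set $S$ with $f(S)\ge\frac{1-e^{-2}}2 f(T)$ for every feasible $T$; and for this $\varepsilon$ the modified algorithm (with some way of breaking ties) can be implemented in time $\tilde O(n^6)=O(n^6\log^{O(1)}n)$, given a value oracle for $f$ and an independence oracle for $\mathcal M$, where each oracle call, each arithmetic operation or comparison of numbers, and each insertion, removal or look-up of one element in a set counts as one step. -/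

import Mathlib

namespace MatKnap

/-- An instance of the problem of maximizing a non-negative monotone submodular function
subject to a knapsack and a matroid constraint. The ground set has `n` elements, numbered
`0, …, n - 1`. The condition `0 ≤ B` says that there is a feasible solution. -/
structure Problem (n : ℕ) where
  /-- the objective function -/
  f : Finset (Fin n) → ℝ
  f_nonneg : ∀ S, 0 ≤ f S
  f_mono : ∀ S T, S ⊆ T → f S ≤ f T
  f_submodular : ∀ R T, f (R ∪ T) + f (R ∩ T) ≤ f R + f T
  /-- the sizes of the elements -/
  c : Fin n → ℝ
  c_nonneg : ∀ u, 0 ≤ c u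
  /-- the size bound -/
  B : ℝ
  B_nonneg : 0 ≤ B
  /-- the matroid -/
  M : Matroid (Fin n)
  M_ground : M.E = Set.univ

/-! ### The problem and the modified greedy local search -/

section Algorithm

variable {n : ℕ}

/-- The total size of a set. -/
noncomputable def Problem.cost (I : Problem n) (S : Finset (Fin n)) : ℝ := ∑ u ∈ S, I.c u

/-- `S` is independent. -/
def Problem.Indep (I : Problem n) (S : Finset (Fin n)) : Prop := I.M.Indep (S : Set (Fin n))

/-- `S` satisfies both constraints. -/
def Problem.Feasible (I : Problem n) (S : Finset (Fin n)) : Prop :=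
  I.Indep S ∧ I.cost S ≤ I.B

/-- `S` is a feasible solution whose value is at least `r` times the optimum. -/
def Problem.IsApprox (I : Problem n) (r : ℝ) (S : Finset (Fin n)) : Prop :=
  I.Feasible S ∧ ∀ T, I.Feasible T → r * I.f T ≤ I.f S

/-- The set `(S \ {y}) ∪ {x}`; `none` stands for the dummy element `φ`. -/
def exchange (S : Finset (Fin n)) (x : Fin n) : Option (Fin n) → Finset (Fin n)
  | none => insert x S
  | some y => insert x (S.erase y)

/-- `(x, y)` is a swap for `S`: `x` is outside `S`, `y` is in `S` or is the dummy element, and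
the exchange keeps the set independent. -/
def Problem.IsSwap (I : Problem n) (S : Finset (Fin n)) (x : Fin n) (y : Option (Fin n)) :
    Prop :=
  x ∉ S ∧ (∀ z, y = some z → z ∈ S) ∧ I.Indep (exchange S x y)

/-- The change of `f` under an exchange. -/
def Problem.gain (I : Problem n) (S : Finset (Fin n)) (x : Fin n) (y : Option (Fin n)) : ℝ :=
  I.f (exchange S x y) - I.f S

open Classical in
/-- The marginal profit density `(f ((S \ {y}) ∪ {x}) - f S) / c x` of a swap. If `c x = 0`, it
is `+∞` for a swap that increases `f`, and `0` (so that the swap is never made) otherwise. -/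
noncomputable def Problem.density (I : Problem n) (S : Finset (Fin n)) (x : Fin n)
    (y : Option (Fin n)) : EReal :=
  if I.c x = 0 then (if 0 < I.gain S x y then ⊤ else 0)
  else ((I.gain S x y / I.c x : ℝ) : EReal)

/-- The swap `(x, y)` passes the tests of the modified algorithm with guess `Y`: it removes no
element of `Y`, has positive density, respects the knapsack constraint and, unless `y` is the
dummy element, multiplies `f` by at least `1 + ε / n ^ 2`. Only the last requirement is new
compared with the unmodified algorithm. -/
def Problem.Acceptable (I : Problem n) (ε : ℝ) (Y S : Finset (Fin n)) (x : Fin n)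
    (y : Option (Fin n)) : Prop :=
  I.IsSwap S x y ∧ (∀ z, y = some z → z ∉ Y) ∧ 0 < I.density S x y ∧
    I.cost (exchange S x y) ≤ I.B ∧
    (y ≠ none → (1 + ε / (n : ℝ) ^ 2) * I.f S ≤ I.f (exchange S x y))

/-- One greedy swap. Taking the swaps in an order of non-increasing density until one of them
passes the tests means making an acceptable swap of maximum density among the acceptable ones;
ties are broken arbitrarily. -/
def Problem.GreedySwap (I : Problem n) (ε : ℝ) (Y S S' : Finset (Fin n)) : Prop :=
  ∃ x y, I.Acceptable ε Y S x y ∧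
    (∀ x' y', I.Acceptable ε Y S x' y' → I.density S x' y' ≤ I.density S x y) ∧
    S' = exchange S x y

/-- The value of `S` shows that the guess `Y` was wrong, since the right guess `Y` has
`f S ≤ f S* ≤ (n / 2) * f Y` for an optimal solution `S*`. -/
def Problem.Refutes (I : Problem n) (S Y : Finset (Fin n)) : Prop :=
  (n : ℝ) / 2 * I.f Y < I.f S

/-- A greedy swap made while the guess `Y` has not been refuted. -/
def Problem.Step (I : Problem n) (ε : ℝ) (Y S S' : Finset (Fin n)) : Prop :=
  ¬ I.Refutes S Y ∧ I.GreedySwap ε Y S S'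

/-- The set `S` can be the result of the greedy swaps that start from the guess `Y`: they are made
until no acceptable swap is left or the guess is refuted. -/
def Problem.RunResult (I : Problem n) (ε : ℝ) (Y S : Finset (Fin n)) : Prop :=
  Relation.ReflTransGen (I.Step ε Y) Y S ∧ ∀ S', ¬ I.Step ε Y S S'

/-- `S` can be the output of the modified algorithm: one run is made from every feasible pair `Y`,
and `S` has the largest value among the results of these runs and the feasible sets with at most
one element. -/
def Problem.Output (I : Problem n) (ε : ℝ) (S : Finset (Fin n)) : Prop :=
  ∃ result : Finset (Fin n) → Finset (Fin n),
    (∀ Y, Y.card = 2 → I.Feasible Y → I.RunResult ε Y (result Y)) ∧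
    ((S.card ≤ 1 ∧ I.Feasible S) ∨ ∃ Y, Y.card = 2 ∧ I.Feasible Y ∧ S = result Y) ∧
    (∀ T, T.card ≤ 1 → I.Feasible T → I.f T ≤ I.f S) ∧
    (∀ Y, Y.card = 2 → I.Feasible Y → I.f (result Y) ≤ I.f S)

end Algorithm

/-! ### Programs and their running time

A real random access machine with a value oracle for `f` and an independence oracle for the
matroid. It has registers for natural numbers (counters and names of elements), for real numbers,
and for subsets of the ground set, which are bit arrays: one step inserts, removes or looks up one
element. A program is a fixed finite text that does not depend on the instance. -/

/-- The contents of the registers. -/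
structure State (n : ℕ) where
  nat : ℕ → ℕ
  real : ℕ → ℝ
  set : ℕ → Finset (Fin n)

/-- At the start all registers contain `0` or the empty set. -/
def State.init (n : ℕ) : State n := ⟨fun _ => 0, fun _ => 0, fun _ => ∅⟩

def State.setNat {n : ℕ} (σ : State n) (i v : ℕ) : State n :=
  { σ with nat := Function.update σ.nat i v }

def State.setReal {n : ℕ} (σ : State n) (i : ℕ) (v : ℝ) : State n :=
  { σ with real := Function.update σ.real i v }

def State.setSet {n : ℕ} (σ : State n) (i : ℕ) (v : Finset (Fin n)) : State n :=
  { σ with set := Function.update σ.set i v }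

/-- Elementary instructions; the first argument is the number of the target register. -/
inductive Instr where
  /-- store a constant in a number register -/
  | natConst (i k : ℕ)
  | natCopy (i j : ℕ)
  /-- increase a number register by one -/
  | natSucc (i : ℕ)
  /-- store `n` in a number register -/
  | groundCard (i : ℕ)
  /-- store a rational constant in a real register -/
  | realConst (i : ℕ) (q : ℚ)
  | realCopy (i j : ℕ)
  /-- convert the content of a number register -/
  | realOfNat (i j : ℕ)
  | realAdd (i j k : ℕ)
  | realSub (i j k : ℕ)
  | realMul (i j k : ℕ)
  | realDiv (i j k : ℕ)
  /-- read the size of the element named by number register `j` -/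
  | readSize (i j : ℕ)
  /-- read the size bound -/
  | readBound (i : ℕ)
  /-- ask the value oracle for the value of `f` at set register `s` -/
  | askValue (i s : ℕ)
  /-- put the element named by number register `j` into set register `s` -/
  | putElem (s j : ℕ)
  /-- remove the element named by number register `j` from set register `s` -/
  | dropElem (s j : ℕ)

/-- Elementary tests. -/
inductive Cond where
  | natEq (i j : ℕ)
  | natLt (i j : ℕ)
  | realLe (i j : ℕ)
  | realLt (i j : ℕ)
  /-- the element named by number register `j` is in set register `s` -/
  | mem (s j : ℕ)
  /-- ask the independence oracle about set register `s` -/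
  | indep (s : ℕ)

/-- The effect of an instruction. Numbers that do not name an element have size `0`, and inserting
or removing them has no effect. -/
noncomputable def Instr.apply {n : ℕ} (I : Problem n) (σ : State n) : Instr → State n
  | .natConst i k => σ.setNat i k
  | .natCopy i j => σ.setNat i (σ.nat j)
  | .natSucc i => σ.setNat i (σ.nat i + 1)
  | .groundCard i => σ.setNat i n
  | .realConst i q => σ.setReal i (q : ℝ)
  | .realCopy i j => σ.setReal i (σ.real j)
  | .realOfNat i j => σ.setReal i (σ.nat j : ℝ)
  | .realAdd i j k => σ.setReal i (σ.real j + σ.real k)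
  | .realSub i j k => σ.setReal i (σ.real j - σ.real k)
  | .realMul i j k => σ.setReal i (σ.real j * σ.real k)
  | .realDiv i j k => σ.setReal i (σ.real j / σ.real k)
  | .readSize i j => σ.setReal i (if h : σ.nat j < n then I.c ⟨σ.nat j, h⟩ else 0)
  | .readBound i => σ.setReal i I.B
  | .askValue i s => σ.setReal i (I.f (σ.set s))
  | .putElem s j =>
      if h : σ.nat j < n then σ.setSet s (insert ⟨σ.nat j, h⟩ (σ.set s)) else σ
  | .dropElem s j =>
      if h : σ.nat j < n then σ.setSet s ((σ.set s).erase ⟨σ.nat j, h⟩) else σ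

/-- The truth of a test. -/
def Cond.Holds {n : ℕ} (I : Problem n) (σ : State n) : Cond → Prop
  | .natEq i j => σ.nat i = σ.nat j
  | .natLt i j => σ.nat i < σ.nat j
  | .realLe i j => σ.real i ≤ σ.real j
  | .realLt i j => σ.real i < σ.real j
  | .mem s j => ∃ h : σ.nat j < n, (⟨σ.nat j, h⟩ : Fin n) ∈ σ.set s
  | .indep s => I.Indep (σ.set s)

/-- Programs. -/
inductive Prog where
  | skip
  | instr (a : Instr)
  | seq (p q : Prog)
  /-- `if b then p else q` -/
  | branch (b : Cond) (p q : Prog)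
  /-- `while b do p` -/
  | loop (b : Cond) (p : Prog)

/-- `Exec I p σ τ t`: on the instance `I`, started in the state `σ`, the program `p` halts in the
state `τ` after `t` steps. Every instruction and every evaluation of a test (in particular every
oracle call) is one step. -/
inductive Exec {n : ℕ} (I : Problem n) : Prog → State n → State n → ℕ → Prop where
  | skip (σ : State n) : Exec I .skip σ σ 0
  | instr (a : Instr) (σ : State n) : Exec I (.instr a) σ (a.apply I σ) 1
  | seq {p q : Prog} {σ τ υ : State n} {s t : ℕ} :
      Exec I p σ τ s → Exec I q τ υ t → Exec I (.seq p q) σ υ (s + t)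
  | branchTrue {b : Cond} {p q : Prog} {σ τ : State n} {t : ℕ} :
      b.Holds I σ → Exec I p σ τ t → Exec I (.branch b p q) σ τ (t + 1)
  | branchFalse {b : Cond} {p q : Prog} {σ τ : State n} {t : ℕ} :
      ¬ b.Holds I σ → Exec I q σ τ t → Exec I (.branch b p q) σ τ (t + 1)
  | loopTrue {b : Cond} {p : Prog} {σ τ υ : State n} {s t : ℕ} :
      b.Holds I σ → Exec I p σ τ s → Exec I (.loop b p) τ υ t →
        Exec I (.loop b p) σ υ (s + t + 1)
  | loopFalse {b : Cond} {p : Prog} {σ : State n} :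
      ¬ b.Holds I σ → Exec I (.loop b p) σ σ 1

/-- On the instance `I` the program `p` halts within `T` steps, with `S` in set register `0`. -/
def Prog.ComputesWithin {n : ℕ} (p : Prog) (I : Problem n) (S : Finset (Fin n)) (T : ℝ) : Prop :=
  ∃ τ t, Exec I p (State.init n) τ t ∧ τ.set 0 = S ∧ (t : ℝ) ≤ T

end MatKnap

/-! Approximation. Let T be an optimal solution with at least two elements, and let Y ⊆ T be the
pair chosen greedily from T. Submodularity gives f(T) ≤ (n/2) f(Y), and every further element of T
has marginal value at most f(Y)/2 over Y (`exists_greedy_pair`). So Y is never refuted, and only the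
run that starts from Y has to be analysed.

Hall's theorem matches T \ S injectively into (S \ T) ∪ {φ} by exchanges that keep S independent
(`exists_exchange_map`). These swaps spare Y and gain at least f(T) - 2 f(S) + f(Y) in total
(`le_sum_gain`). Those rejected by the threshold 1 + ε/n² account for at most (ε/n) f(T), so the
others gain at least `gap`. As they insert elements of total size at most `room`, one of them has
density at least gap / room (`exists_swap`). A greedy swap is at least as dense, so inserting size c
multiplies the gap by at most e^(-2c/room) (`gap_exchange_le`).

This continues until the dense swap does not fit. If it were made anyway, more than `room` would
have been inserted, so the gap would have fallen below e^(-2) times its initial value. Giving up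
that swap costs at most f(Y)/2, and the terms in f(Y) then add up to a surplus of (e^(-2)/2) f(Y).
This surplus pays for the rejected swaps once ε ≤ e^(-2) (`exists_acceptable`).

Time. A run has at most n insertions of a new element without removal. Every other swap multiplies f
by 1 + ε/n², while f ≤ (n/2) f(Y) until refutation; so there are O(n² log n) of them
(`ReachedIn.lt_maxSwaps`). A search inspects O(n²) swaps in constant time each, and there are O(n²)
guesses, which makes O(n⁶ log n). Correctness and time of the explicit program are proved together
through the predicate `Wp`. -/

namespace MatKnap

/-! ### Exchanges between two independent sets -/

/-- Every element of an independent set `T` outside an independent set `S` can be exchanged for an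
element of `S \ T`, or just added, such that no element of `S` is used twice. -/
theorem exists_exchange_map {n : ℕ} (M : Matroid (Fin n)) {S T : Finset (Fin n)}
    (hS : M.Indep (S : Set (Fin n))) (hT : M.Indep (T : Set (Fin n))) :
    ∃ π : Fin n → Option (Fin n),
      (∀ x ∈ T \ S, (∀ y, π x = some y → y ∈ S \ T) ∧
        M.Indep (exchange S x (π x) : Set (Fin n))) ∧
      ∀ x ∈ T \ S, ∀ x' ∈ T \ S, ∀ y, π x = some y → π x' = some y → x = x' := by
  classical
  -- Only elements that cannot simply be added need a partner; the others get the dummy.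
  let ι := {x : Fin n // x ∈ T \ S ∧ ¬ M.Indep (insert x (S : Set (Fin n)))}
  let t : ι → Finset (Fin n) := fun x =>
    (S \ T).filter fun y => M.Indep (insert x.1 (S.erase y) : Finset (Fin n))
  -- Hall's condition. The fundamental circuit of x in S + x, without x, lies in N ∪ (S ∩ T). So N ∪
  -- (S ∩ T) spans X' ∪ (S ∩ T), which is independent as a subset of T, and comparing ranks gives
  -- |X'| ≤ |N|.
  have key : ∀ X : Finset ι, X.card ≤ (X.biUnion t).card := by
    intro X
    set N := X.biUnion t
    let X' : Finset (Fin n) := X.map (Function.Embedding.subtype _)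
    have hX'T : X' ⊆ T \ S := by
      intro x hx
      obtain ⟨z, -, rfl⟩ := Finset.mem_map.1 hx
      exact z.2.1
    have hNS : N ⊆ S \ T := by
      intro y hy
      obtain ⟨z, -, hz⟩ := Finset.mem_biUnion.1 hy
      exact (Finset.mem_filter.1 hz).1
    have hcl : ((X' ∪ (S ∩ T) : Finset (Fin n)) : Set (Fin n)) ⊆
        M.closure ((N ∪ (S ∩ T) : Finset (Fin n)) : Set (Fin n)) := by
      have hground : ((N ∪ (S ∩ T) : Finset (Fin n)) : Set (Fin n)) ⊆ M.E := by
        refine subset_trans ?_ hS.subset_ground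
        intro y hy
        rcases Finset.mem_union.1 (Finset.mem_coe.1 hy) with h | h
        · exact (Finset.mem_sdiff.1 (hNS h)).1
        · exact (Finset.mem_inter.1 h).1
      intro x hx
      rcases Finset.mem_union.1 (Finset.mem_coe.1 hx) with h | h
      · obtain ⟨z, hzX, rfl⟩ := Finset.mem_map.1 h
        have hzS : (z : Fin n) ∉ (S : Set (Fin n)) := by
          simpa using (Finset.mem_sdiff.1 z.2.1).2
        have hzT : (z : Fin n) ∈ (T : Set (Fin n)) := (Finset.mem_sdiff.1 z.2.1).1
        have hzcl : (z : Fin n) ∈ M.closure (S : Set (Fin n)) := by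
          by_contra hcon
          exact z.2.2 ((hS.insert_indep_iff_of_notMem hzS).2
            ⟨hT.subset_ground hzT, hcon⟩)
        have hC := hS.fundCircuit_isCircuit hzcl hzS
        have hmem := hC.mem_closure_sdiff_singleton_of_mem (M.mem_fundCircuit z.1 S)
        refine M.closure_subset_closure ?_ hmem
        rintro y ⟨hyC, hyz⟩
        have hyz' : y ≠ z := hyz
        have hyS : y ∈ S := by
          rcases M.fundCircuit_subset_insert z.1 S hyC with h | h
          · exact absurd h hyz'
          · exact h
        have hind : M.Indep (insert z.1 (S : Set (Fin n)) \ {y}) :=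
          (hS.mem_fundCircuit_iff hzcl hzS).1 hyC
        rw [Finset.mem_coe, Finset.mem_union, Finset.mem_inter]
        by_cases hyT : y ∈ T
        · exact Or.inr ⟨hyS, hyT⟩
        · refine Or.inl (Finset.mem_biUnion.2 ⟨z, hzX, Finset.mem_filter.2
            ⟨Finset.mem_sdiff.2 ⟨hyS, hyT⟩, ?_⟩⟩)
          convert hind using 1
          ext w
          simp only [Finset.coe_insert, Finset.coe_erase, Set.mem_insert_iff, Set.mem_sdiff,
            Set.mem_singleton_iff]
          constructor
          · rintro (rfl | h)
            · exact ⟨Or.inl rfl, fun h => hyz' h.symm⟩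
            · exact ⟨Or.inr h.1, h.2⟩
          · rintro ⟨h | h, h'⟩
            · exact Or.inl h
            · exact Or.inr ⟨h, h'⟩
      · exact M.subset_closure _ hground (Finset.mem_union_right _ h)
    have hind : M.Indep ((X' ∪ (S ∩ T) : Finset (Fin n)) : Set (Fin n)) := by
      refine hT.subset ?_
      intro x hx
      rcases Finset.mem_union.1 (Finset.mem_coe.1 hx) with h | h
      · exact (Finset.mem_sdiff.1 (hX'T h)).1
      · exact (Finset.mem_inter.1 h).2
    have hcard : (X' ∪ (S ∩ T)).card ≤ (N ∪ (S ∩ T)).card := by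
      have h1 := M.eRk_mono hcl
      rw [hind.eRk_eq_encard, M.eRk_closure_eq] at h1
      have h2 := h1.trans (M.eRk_le_encard _)
      rw [Set.encard_coe_eq_coe_finsetCard, Set.encard_coe_eq_coe_finsetCard] at h2
      exact_mod_cast h2
    have hd1 : Disjoint X' (S ∩ T) := by
      rw [Finset.disjoint_left]
      intro x hx hx'
      exact (Finset.mem_sdiff.1 (hX'T hx)).2 (Finset.mem_inter.1 hx').1
    have hd2 : Disjoint N (S ∩ T) := by
      rw [Finset.disjoint_left]
      intro x hx hx'
      exact (Finset.mem_sdiff.1 (hNS hx)).2 (Finset.mem_inter.1 hx').2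
    rw [Finset.card_union_of_disjoint hd1, Finset.card_union_of_disjoint hd2,
      Finset.card_map] at hcard
    omega
  obtain ⟨g, hg, hgt⟩ := (Finset.all_card_le_biUnion_card_iff_exists_injective t).1 key
  refine ⟨fun x => if h : x ∈ T \ S ∧ ¬ M.Indep (insert x (S : Set (Fin n))) then
    some (g ⟨x, h⟩) else none, ?_, ?_⟩
  · intro x hx
    by_cases h : x ∈ T \ S ∧ ¬ M.Indep (insert x (S : Set (Fin n)))
    · have := Finset.mem_filter.1 (hgt ⟨x, h⟩)
      simp only [dif_pos h, Option.some.injEq, forall_eq']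
      exact this
    · simp only [dif_neg h, reduceCtorEq, false_implies, implies_true, true_and, exchange,
        Finset.coe_insert]
      by_contra hcon
      exact h ⟨hx, hcon⟩
  · intro x hx x' hx' y h h'
    by_cases hd : x ∈ T \ S ∧ ¬ M.Indep (insert x (S : Set (Fin n)))
    · by_cases hd' : x' ∈ T \ S ∧ ¬ M.Indep (insert x' (S : Set (Fin n)))
      · simp only [dif_pos hd, dif_pos hd', Option.some.injEq] at h h'
        have := hg (h.trans h'.symm)
        exact congrArg Subtype.val this
      · simp only [dif_neg hd', reduceCtorEq] at h'
    · simp only [dif_neg hd, reduceCtorEq] at h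

namespace Problem

variable {n : ℕ} (I : Problem n)

/-! ### Consequences of submodularity -/

theorem f_insert_sub_le_of_subset {R S : Finset (Fin n)} (hRS : R ⊆ S) {x : Fin n} (hx : x ∉ S) :
    I.f (insert x S) - I.f S ≤ I.f (insert x R) - I.f R := by
  have h := I.f_submodular (insert x R) S
  have h1 : insert x R ∪ S = insert x S := by
    rw [Finset.insert_union, Finset.union_eq_right.2 hRS]
  have h2 : insert x R ∩ S = R := by
    rw [Finset.insert_inter_of_notMem hx, Finset.inter_eq_left.2 hRS]
  rw [h1, h2] at h
  linarith

theorem f_union_sub_le_sum (S A : Finset (Fin n)) (hA : Disjoint S A) :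
    I.f (S ∪ A) - I.f S ≤ ∑ x ∈ A, (I.f (insert x S) - I.f S) := by
  induction A using Finset.induction_on with
  | empty => simp
  | insert a A ha ih =>
    rw [Finset.sum_insert ha]
    rw [Finset.disjoint_insert_right] at hA
    have h1 := ih hA.2
    have h2 := I.f_insert_sub_le_of_subset (Finset.subset_union_left (s₁ := S) (s₂ := A))
      (x := a) (by simp [ha, hA.1])
    rw [Finset.union_insert]
    linarith

/-- When the elements of A are removed one after another, each removal loses at least as much as it
would from the whole of S. -/
theorem sum_sub_f_erase_le (S A : Finset (Fin n)) (hA : A ⊆ S) :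
    ∑ y ∈ A, (I.f S - I.f (S.erase y)) ≤ I.f S - I.f (S \ A) := by
  induction A using Finset.induction_on with
  | empty => simp
  | insert a A ha ih =>
    rw [Finset.sum_insert ha]
    have haS : a ∈ S := hA (Finset.mem_insert_self _ _)
    have h1 := ih ((Finset.subset_insert _ _).trans hA)
    have hsub : S \ insert a A ⊆ S.erase a := by
      intro z hz
      simp only [Finset.mem_sdiff, Finset.mem_insert, not_or] at hz
      exact Finset.mem_erase.2 ⟨hz.2.1, hz.1⟩
    have h2 := I.f_insert_sub_le_of_subset hsub (x := a) (by simp)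
    rw [Finset.insert_erase haS] at h2
    have h3 : insert a (S \ insert a A) = S \ A := by
      ext z
      simp only [Finset.mem_insert, Finset.mem_sdiff, not_or]
      constructor
      · rintro (rfl | h)
        · exact ⟨haS, ha⟩
        · exact ⟨h.1, h.2.2⟩
      · rintro ⟨h, h'⟩
        by_cases hz : z = a
        · exact Or.inl hz
        · exact Or.inr ⟨h, hz, h'⟩
    rw [h3] at h2
    linarith

/-- The total gain of the swaps given by an injective exchange map. -/
theorem le_sum_gain {S T Y : Finset (Fin n)} (hYS : Y ⊆ S) (hYT : Y ⊆ T)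
    {π : Fin n → Option (Fin n)}
    (hπ : ∀ x ∈ T \ S, ∀ y, π x = some y → y ∈ S \ T)
    (hinj : ∀ x ∈ T \ S, ∀ x' ∈ T \ S, ∀ y, π x = some y → π x' = some y → x = x') :
    I.f T - 2 * I.f S + I.f Y ≤ ∑ x ∈ T \ S, I.gain S x (π x) := by
  classical
  let l : Fin n → ℝ := fun y => I.f S - I.f (S.erase y)
  have hl : ∀ y, 0 ≤ l y := fun y => sub_nonneg.2 (I.f_mono _ _ (Finset.erase_subset _ _))
  -- Removing y first can only raise the marginal value of x, so the swap loses at most `l y`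
  -- compared with inserting x into S.
  have hgain : ∀ x ∈ T \ S, (I.f (insert x S) - I.f S) -
      ∑ y ∈ S \ T, (if π x = some y then l y else 0) ≤ I.gain S x (π x) := by
    intro x hx
    have hxS : x ∉ S := (Finset.mem_sdiff.1 hx).2
    cases hp : π x with
    | none => simp [gain, exchange]
    | some y =>
      have hy := hπ x hx y hp
      have hsum : ∑ z ∈ S \ T, (if some y = some z then l z else 0) = l y := by
        simp only [Option.some.injEq]
        rw [Finset.sum_ite_eq, if_pos hy]
      rw [hsum]
      have := I.f_insert_sub_le_of_subset (Finset.erase_subset y S) hxS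
      simp only [gain, exchange, l]
      linarith
  have h1 := Finset.sum_le_sum hgain
  rw [Finset.sum_sub_distrib, Finset.sum_comm] at h1
  -- By injectivity each loss `l y` is charged at most once.
  have h2 : ∀ y ∈ S \ T, ∑ x ∈ T \ S, (if π x = some y then l y else 0) ≤ l y := by
    intro y _
    rw [← Finset.sum_filter, Finset.sum_const]
    have hcard : ((T \ S).filter fun x => π x = some y).card ≤ 1 := by
      refine Finset.card_le_one.2 ?_
      intro a ha b hb
      rw [Finset.mem_filter] at ha hb
      exact hinj a ha.1 b hb.1 y ha.2 hb.2
    rw [nsmul_eq_mul]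
    have : (((T \ S).filter fun x => π x = some y).card : ℝ) ≤ 1 := by exact_mod_cast hcard
    nlinarith [hl y]
  have h3 := Finset.sum_le_sum h2
  have h4 := I.sum_sub_f_erase_le S (S \ T) Finset.sdiff_subset
  have h5 := I.f_union_sub_le_sum S (T \ S) Finset.disjoint_sdiff
  rw [Finset.union_sdiff_self_eq_union] at h5
  have h6 := I.f_mono T (S ∪ T) Finset.subset_union_right
  -- Only elements outside T are removed; what stays is S ∩ T, which contains Y.
  have h7 : I.f Y ≤ I.f (S \ (S \ T)) := by
    refine I.f_mono _ _ fun z hz => ?_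
    simp [hYS hz, hYT hz]
  simp only [l] at h1 h3
  linarith

/-! ### Sizes, densities and steps -/

theorem cost_mono {S T : Finset (Fin n)} (h : S ⊆ T) : I.cost S ≤ I.cost T :=
  Finset.sum_le_sum_of_subset_of_nonneg h fun u _ _ => I.c_nonneg u

theorem cost_exchange_none {S : Finset (Fin n)} {x : Fin n} (hx : x ∉ S) :
    I.cost (exchange S x none) = I.cost S + I.c x := by
  simp only [cost, exchange, Finset.sum_insert hx]
  ring

theorem cost_exchange_some {S : Finset (Fin n)} {x y : Fin n} (hx : x ∉ S) (hy : y ∈ S) :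
    I.cost (exchange S x (some y)) = I.cost S - I.c y + I.c x := by
  have hx' : x ∉ S.erase y := fun h => hx (Finset.mem_of_mem_erase h)
  simp only [cost, exchange, Finset.sum_insert hx', ← Finset.add_sum_erase S I.c hy]
  ring

theorem IsSwap.cost_exchange_le {I : Problem n} {S : Finset (Fin n)} {x : Fin n}
    {y : Option (Fin n)} (h : I.IsSwap S x y) : I.cost (exchange S x y) ≤ I.cost S + I.c x := by
  cases y with
  | none => exact (I.cost_exchange_none h.1).le
  | some y =>
    rw [I.cost_exchange_some h.1 (h.2.1 y rfl)]
    linarith [I.c_nonneg y]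

theorem density_pos_iff {S : Finset (Fin n)} {x : Fin n} {y : Option (Fin n)} :
    0 < I.density S x y ↔ 0 < I.gain S x y := by
  unfold density
  split_ifs with h1 h2
  · simp [h2]
  · simp [h2]
  · have hc : 0 < I.c x := lt_of_le_of_ne (I.c_nonneg x) (Ne.symm h1)
    rw [EReal.coe_pos, div_pos_iff_of_pos_right hc]

theorem subset_exchange {S Y : Finset (Fin n)} {x : Fin n} {y : Option (Fin n)}
    (hYS : Y ⊆ S) (hy : ∀ z, y = some z → z ∉ Y) : Y ⊆ exchange S x y := by
  intro w hw
  cases y with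
  | none => exact Finset.mem_insert_of_mem (hYS hw)
  | some y =>
    refine Finset.mem_insert_of_mem (Finset.mem_erase.2 ⟨?_, hYS hw⟩)
    rintro rfl
    exact hy w rfl hw

theorem Step.lt {I : Problem n} {ε : ℝ} {Y S S' : Finset (Fin n)} (h : I.Step ε Y S S') :
    I.f S < I.f S' := by
  obtain ⟨-, x, y, ha, -, rfl⟩ := h
  have := I.density_pos_iff.1 ha.2.2.1
  unfold gain at this
  linarith

theorem Step.feasible {I : Problem n} {ε : ℝ} {Y S S' : Finset (Fin n)} (h : I.Step ε Y S S') :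
    I.Feasible S' := by
  obtain ⟨-, x, y, ha, -, rfl⟩ := h
  exact ⟨ha.1.2.2, ha.2.2.2.1⟩

theorem Step.subset {I : Problem n} {ε : ℝ} {Y S S' : Finset (Fin n)} (h : I.Step ε Y S S')
    (hY : Y ⊆ S) : Y ⊆ S' := by
  obtain ⟨-, x, y, ha, -, rfl⟩ := h
  exact subset_exchange hY ha.2.1

theorem RunResult.feasible {I : Problem n} {ε : ℝ} {Y S : Finset (Fin n)}
    (h : I.RunResult ε Y S) (hY : I.Feasible Y) : I.Feasible S := by
  induction h.1 with
  | refl => exact hY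
  | tail _ hstep _ => exact hstep.feasible

end Problem
namespace Problem

variable {n : ℕ} (I : Problem n)

/-! ### The approximation ratio -/

/-- A greedily chosen pair in `T`. -/
theorem exists_greedy_pair {T : Finset (Fin n)} (hT : 2 ≤ T.card) :
    ∃ Y ⊆ T, Y.card = 2 ∧ I.f T ≤ n / 2 * I.f Y ∧
      ∀ x ∈ T \ Y, I.f (insert x Y) - I.f Y ≤ I.f Y / 2 := by
  have hne : T.Nonempty := Finset.card_pos.1 (by omega)
  obtain ⟨a, haT, ha⟩ := T.exists_max_image (fun u => I.f {u}) hne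
  have hne' : (T.erase a).Nonempty := Finset.card_pos.1 (by
    rw [Finset.card_erase_of_mem haT]; omega)
  obtain ⟨b, hbT, hb⟩ := (T.erase a).exists_max_image (fun u => I.f (insert u {a})) hne'
  obtain ⟨hba, hbT⟩ := Finset.mem_erase.1 hbT
  have hYT : insert b {a} ⊆ T := by
    intro z hz
    rcases Finset.mem_insert.1 hz with rfl | h
    · exact hbT
    · rwa [Finset.mem_singleton.1 h]
  have hcard : (insert b {a} : Finset (Fin n)).card = 2 := by
    rw [Finset.card_insert_of_notMem (by simpa using hba), Finset.card_singleton]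
  -- The choice of b bounds the marginal value of x by f(Y) - f({a}). The choice of a bounds this by
  -- f({a}), so it is the smaller of two parts that make up f(Y).
  have hmarg : ∀ x ∈ T \ insert b {a},
      I.f (insert x (insert b {a})) - I.f (insert b {a}) ≤ I.f (insert b {a}) / 2 := by
    intro x hx
    obtain ⟨hxT, hxY⟩ := Finset.mem_sdiff.1 hx
    have hxa : x ≠ a := by rintro rfl; exact hxY (by simp)
    have h1 := I.f_insert_sub_le_of_subset (Finset.subset_insert b {a}) hxY
    have h2 := hb x (Finset.mem_erase.2 ⟨hxa, hxT⟩)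
    have h3 := I.f_insert_sub_le_of_subset (Finset.empty_subset {a}) (x := b) (by simpa using hba)
    have h4 := ha b hbT
    have h5 := I.f_nonneg ∅
    simp only [insert_empty_eq] at h3
    linarith
  refine ⟨_, hYT, hcard, ?_, hmarg⟩
  -- At most n - 2 further elements add f(Y)/2 each: 1 + (n - 2)/2 = n/2.
  have h1 := I.f_union_sub_le_sum (insert b {a}) (T \ insert b {a}) Finset.disjoint_sdiff
  rw [Finset.union_sdiff_of_subset hYT] at h1
  have h2 := Finset.sum_le_sum hmarg
  rw [Finset.sum_const, nsmul_eq_mul, Finset.card_sdiff_of_subset hYT, hcard] at h2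
  have h3 : ((T.card - 2 : ℕ) : ℝ) ≤ n - 2 := by
    rw [Nat.cast_sub hT]
    have : (T.card : ℝ) ≤ n := by exact_mod_cast (Finset.card_le_univ T).trans_eq (by simp)
    push_cast
    linarith
  have h4 := mul_le_mul_of_nonneg_right h3 (div_nonneg (I.f_nonneg (insert b {a})) zero_le_two)
  linarith

/-- What the analysis assumes about the optimal solution `T` and the guess `Y`. -/
structure RightGuess (ε : ℝ) (T Y : Finset (Fin n)) : Prop where
  feasible : I.Feasible T
  optimal : ∀ S, I.Feasible S → I.f S ≤ I.f T
  subset : Y ⊆ T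
  two_le : 2 ≤ n
  le_mul : I.f T ≤ n / 2 * I.f Y
  marginal : ∀ x ∈ T \ Y, I.f (insert x Y) - I.f Y ≤ I.f Y / 2
  eps_pos : 0 < ε
  eps_le : ε ≤ Real.exp (-2)

/-- The target for the gain over the guess, reduced by what the swaps with a small gain lose. -/
noncomputable def target (ε : ℝ) (T Y : Finset (Fin n)) : ℝ :=
  (1 - ε / n) * I.f T - I.f Y

/-- A lower bound for the total gain of the useful swaps into `T`. -/
noncomputable def gap (ε : ℝ) (T Y S : Finset (Fin n)) : ℝ :=
  I.target ε T Y - 2 * (I.f S - I.f Y)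

/-- The part of the knapsack that the guess leaves free. -/
noncomputable def room (Y : Finset (Fin n)) : ℝ := I.B - I.cost Y

/-! ### The run that starts from the right guess -/

namespace RightGuess

variable {I} {ε : ℝ} {T Y : Finset (Fin n)}

theorem room_nonneg (h : I.RightGuess ε T Y) : 0 ≤ I.room Y :=
  sub_nonneg.2 ((I.cost_mono h.subset).trans h.feasible.2)

/-- The loss caused by the threshold is expressed through f(Y), where the analysis has a surplus. -/
theorem eps_div_le (h : I.RightGuess ε T Y) : ε / n * I.f T ≤ ε / 2 * I.f Y := by
  have hn : (0 : ℝ) < n := by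
    have := h.two_le
    exact_mod_cast (by omega : 0 < n)
  have := mul_le_mul_of_nonneg_left h.le_mul (div_nonneg h.eps_pos.le hn.le)
  refine this.trans_eq ?_
  field_simp

theorem cost_sdiff_le (h : I.RightGuess ε T Y) {A : Finset (Fin n)} (hA : A ⊆ T \ Y) :
    ∑ x ∈ A, I.c x ≤ I.room Y := by
  have h1 : I.cost A ≤ I.cost (T \ Y) := I.cost_mono hA
  have h2 : I.cost (T \ Y) + I.cost Y = I.cost T := Finset.sum_sdiff h.subset
  have h3 := h.feasible.2
  unfold room
  change I.cost A ≤ _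
  linarith

/-- Here 2 f(S) ≥ f(T) + f(Y) - (ε/n) f(T), and the loss is at most f(Y), so S even reaches half the
optimum. -/
theorem done_of_gap_nonpos (h : I.RightGuess ε T Y) {S : Finset (Fin n)}
    (hS : I.gap ε T Y S ≤ 0) : (1 - Real.exp (-2)) / 2 * I.f T ≤ I.f S := by
  have h1 := h.eps_div_le
  have h2 := h.eps_le
  have h3 : Real.exp (-2) ≤ 1 := Real.exp_le_one_iff.2 (by norm_num)
  have h4 := Real.exp_pos (-2)
  have h5 := I.f_nonneg T
  have h6 := I.f_nonneg Y
  unfold gap target at hS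
  nlinarith

/-- The useful swaps into `T`. -/
theorem exists_swap (h : I.RightGuess ε T Y) {S : Finset (Fin n)} (hS : I.Feasible S)
    (hYS : Y ⊆ S) (hgap : 0 < I.gap ε T Y S) :
    ∃ x ∈ T \ S, ∃ y, I.IsSwap S x y ∧ (∀ z, y = some z → z ∉ Y) ∧ 0 < I.gain S x y ∧
      (y ≠ none → (1 + ε / (n : ℝ) ^ 2) * I.f S ≤ I.f (exchange S x y)) ∧
      I.gap ε T Y S / I.room Y * I.c x ≤ I.gain S x y := by
  classical
  obtain ⟨π, hπ, hinj⟩ := exists_exchange_map I.M hS.1 h.feasible.1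
  have hsum := I.le_sum_gain hYS h.subset (fun x hx => (hπ x hx).1) hinj
  have hn : (0 : ℝ) < n := by
    have := h.two_le
    exact_mod_cast (by omega : 0 < n)
  let p : Fin n → Prop := fun x => 0 < I.gain S x (π x) ∧
    (π x ≠ none → (1 + ε / (n : ℝ) ^ 2) * I.f S ≤ I.f (exchange S x (π x)))
  have hδ : 0 ≤ ε / (n : ℝ) ^ 2 * I.f S :=
    mul_nonneg (div_nonneg h.eps_pos.le (by positivity)) (I.f_nonneg S)
  -- A failing exchange gains at most (ε/n²) f(S); there are at most n of them, and f(S) ≤ f(T).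
  have hbad : ∑ x ∈ (T \ S).filter (fun x => ¬ p x), I.gain S x (π x) ≤ ε / n * I.f T := by
    have hb : ∀ x ∈ (T \ S).filter (fun x => ¬ p x),
        I.gain S x (π x) ≤ ε / (n : ℝ) ^ 2 * I.f S := by
      intro x hx
      have hx' := (Finset.mem_filter.1 hx).2
      by_contra! hcon
      refine hx' ⟨hδ.trans_lt hcon, fun _ => ?_⟩
      unfold gain at hcon
      linarith
    refine (Finset.sum_le_sum hb).trans ?_
    rw [Finset.sum_const, nsmul_eq_mul]
    have hc : (((T \ S).filter fun x => ¬ p x).card : ℝ) ≤ n := by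
      exact_mod_cast (Finset.card_le_univ _).trans_eq (by simp)
    calc _ ≤ (n : ℝ) * (ε / (n : ℝ) ^ 2 * I.f S) := mul_le_mul_of_nonneg_right hc hδ
      _ = ε / n * I.f S := by field_simp
      _ ≤ _ := mul_le_mul_of_nonneg_left (h.optimal S hS) (div_nonneg h.eps_pos.le hn.le)
  rw [← Finset.sum_filter_add_sum_filter_not _ p] at hsum
  have hgood : I.gap ε T Y S ≤ ∑ x ∈ (T \ S).filter p, I.gain S x (π x) := by
    unfold gap target
    linarith
  -- Averaging: if all these densities were below gap / room, the total gain would be below gap.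
  have hex : ∃ x ∈ (T \ S).filter p,
      I.gap ε T Y S / I.room Y * I.c x ≤ I.gain S x (π x) := by
    by_contra! hcon
    have hne : ((T \ S).filter p).Nonempty := by
      by_contra hne
      rw [Finset.not_nonempty_iff_eq_empty.1 hne, Finset.sum_empty] at hgood
      linarith
    have h1 := Finset.sum_lt_sum_of_nonempty hne hcon
    rw [← Finset.mul_sum] at h1
    have h2 : ∑ x ∈ (T \ S).filter p, I.c x ≤ I.room Y := by
      refine h.cost_sdiff_le fun x hx => ?_
      have := Finset.mem_sdiff.1 (Finset.mem_filter.1 hx).1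
      exact Finset.mem_sdiff.2 ⟨this.1, fun hxY => this.2 (hYS hxY)⟩
    have h3 := mul_le_mul_of_nonneg_left h2 (div_nonneg hgap.le h.room_nonneg)
    -- If the room is 0, the quotient is 0 by convention and only the inequality remains.
    have h4 : I.gap ε T Y S / I.room Y * I.room Y ≤ I.gap ε T Y S := by
      rcases eq_or_ne (I.room Y) 0 with h0 | h0
      · simp [h0, hgap.le]
      · rw [div_mul_cancel₀ _ h0]
    linarith
  obtain ⟨x, hx, hd⟩ := hex
  obtain ⟨hxTS, hxg, hxt⟩ := Finset.mem_filter.1 hx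
  have hy := (hπ x hxTS).1
  refine ⟨x, hxTS, π x, ⟨(Finset.mem_sdiff.1 hxTS).2,
    fun z hz => (Finset.mem_sdiff.1 (hy z hz)).1, (hπ x hxTS).2⟩, fun z hz hzY =>
    (Finset.mem_sdiff.1 (hy z hz)).2 (h.subset hzY), hxg, hxt, hd⟩

/-- The bound on the gap decreases exponentially in the size `t` of the inserted elements. -/
def Progress (I : Problem n) (ε : ℝ) (T Y S : Finset (Fin n)) : Prop :=
  (1 - Real.exp (-2)) / 2 * I.f T ≤ I.f S ∨
    ∃ t, I.cost S - I.cost Y ≤ t ∧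
      I.gap ε T Y S ≤ I.target ε T Y * Real.exp (-2 * t / I.room Y)

/-- A gain g lowers the gap by 2g, hence the gap shrinks at least by the factor 1 - 2c/room ≤
e^(-2c/room). Feasibility of the new set is not needed, so this also applies to the swap that does
not fit. -/
theorem gap_exchange_le {S : Finset (Fin n)} (hgap : 0 < I.gap ε T Y S) {t : ℝ}
    (ht : I.gap ε T Y S ≤ I.target ε T Y * Real.exp (-2 * t / I.room Y))
    {x : Fin n} {y : Option (Fin n)}
    (hd : I.gap ε T Y S / I.room Y * I.c x ≤ I.gain S x y) :
    I.gap ε T Y (exchange S x y) ≤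
      I.target ε T Y * Real.exp (-2 * (t + I.c x) / I.room Y) := by
  have h1 : I.gap ε T Y (exchange S x y) = I.gap ε T Y S - 2 * I.gain S x y := by
    unfold gap gain
    ring
  have h2 := Real.add_one_le_exp (-2 * I.c x / I.room Y)
  have h3 := mul_le_mul_of_nonneg_left h2 hgap.le
  have h4 := mul_le_mul_of_nonneg_right ht (Real.exp_pos (-2 * I.c x / I.room Y)).le
  rw [mul_assoc, ← Real.exp_add, ← add_div, ← mul_add] at h4
  have h5 : I.gap ε T Y S * (-2 * I.c x / I.room Y + 1) =
    I.gap ε T Y S - 2 * (I.gap ε T Y S / I.room Y * I.c x) := by ring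
  linarith

/-- Unless the ratio has been reached, a swap of high density passes the tests. -/
theorem exists_acceptable (h : I.RightGuess ε T Y) {S : Finset (Fin n)} (hS : I.Feasible S)
    (hYS : Y ⊆ S) (hP : Progress I ε T Y S)
    (hnd : ¬ (1 - Real.exp (-2)) / 2 * I.f T ≤ I.f S) :
    0 < I.gap ε T Y S ∧ ∃ x y, I.Acceptable ε Y S x y ∧
      ((I.gap ε T Y S / I.room Y : ℝ) : EReal) ≤ I.density S x y := by
  have hgap : 0 < I.gap ε T Y S := by
    by_contra! hcon
    exact hnd (h.done_of_gap_nonpos hcon)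
  obtain ⟨t, htc, ht⟩ := hP.resolve_left hnd
  obtain ⟨x, hx, y, hsw, hyY, hg, hthr, hd⟩ := h.exists_swap hS hYS hgap
  refine ⟨hgap, x, y, ⟨hsw, hyY, I.density_pos_iff.2 hg, ?_, hthr⟩, ?_⟩
  -- A useful swap that overfills the knapsack shows that S is already good enough: the overfull set
  -- has gap at most e^(-2) times the target, and its value exceeds f(S) by at most f(Y)/2.
  · by_contra! hB
    apply hnd
    have hcx := hsw.cost_exchange_le
    have hxT := Finset.mem_sdiff.1 hx
    have hxY : x ∈ T \ Y := Finset.mem_sdiff.2 ⟨hxT.1, fun hxY => hxT.2 (hYS hxY)⟩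
    have hSB := hS.2
    have hroom : I.c x ≤ I.room Y := by
      simpa using h.cost_sdiff_le (Finset.singleton_subset_iff.2 hxY)
    -- Overfilling forces c x > 0, which rules out the degenerate room 0.
    have hpos : 0 < I.room Y := by linarith
    have hlt : I.room Y ≤ t + I.c x := by unfold room; linarith
    have h1 := gap_exchange_le hgap ht hd
    have htarget : 0 < I.target ε T Y := by
      by_contra! hcon
      have := mul_nonpos_of_nonpos_of_nonneg hcon (Real.exp_pos (-2 * t / I.room Y)).le
      linarith
    have h2 : Real.exp (-2 * (t + I.c x) / I.room Y) ≤ Real.exp (-2) := by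
      refine Real.exp_le_exp.2 ?_
      rw [div_le_iff₀ hpos]
      linarith
    have h3 := mul_le_mul_of_nonneg_left h2 htarget.le
    have h4 : I.f (exchange S x y) ≤ I.f (insert x S) := by
      refine I.f_mono _ _ ?_
      cases y with
      | none => exact subset_rfl
      | some y => exact Finset.insert_subset_insert _ (Finset.erase_subset _ _)
    have h5 := I.f_insert_sub_le_of_subset hYS hxT.2
    have h6 := h.marginal x hxY
    have h7 := h.eps_div_le
    have h8 := h.eps_le
    have h9 : Real.exp (-2) ≤ 1 := Real.exp_le_one_iff.2 (by norm_num)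
    have h10 := Real.exp_pos (-2)
    have h11 := I.f_nonneg Y
    have h12 : I.target ε T Y - 2 * (I.f (exchange S x y) - I.f Y) ≤
        I.target ε T Y * Real.exp (-2) := h1.trans h3
    have h13 : (1 - Real.exp (-2)) / 2 * I.target ε T Y ≤ I.f S - I.f Y / 2 := by linarith
    -- The coefficient of f(Y) left over is 1/2 - (1 - e^(-2))/2 = e^(-2)/2. It absorbs the
    -- threshold loss because ε ≤ e^(-2).
    have h14 : (1 - Real.exp (-2)) / 2 * (ε / n * I.f T) ≤ Real.exp (-2) / 2 * I.f Y := by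
      have : ε / 2 * I.f Y ≤ Real.exp (-2) / 2 * I.f Y :=
        mul_le_mul_of_nonneg_right (by linarith) h11
      have hnn : 0 ≤ ε / n * I.f T :=
        mul_nonneg (div_nonneg h.eps_pos.le (Nat.cast_nonneg n)) (I.f_nonneg T)
      nlinarith
    unfold target at h13
    linarith
  · unfold density
    split_ifs with h1
    · exact le_top
    · have hc : 0 < I.c x := lt_of_le_of_ne (I.c_nonneg x) (Ne.symm h1)
      exact EReal.coe_le_coe_iff.2 ((le_div_iff₀ hc).2 hd)

/-- The swap made is at least as dense as the one from `exists_acceptable`. The parameter t adds up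
inserted sizes and is not reduced by removals, so it stays an upper bound for the size added to Y.
-/
theorem Progress.step (h : I.RightGuess ε T Y) {S S' : Finset (Fin n)} (hS : I.Feasible S)
    (hYS : Y ⊆ S) (hP : Progress I ε T Y S) (hst : I.Step ε Y S S') :
    Progress I ε T Y S' := by
  by_cases hnd : (1 - Real.exp (-2)) / 2 * I.f T ≤ I.f S
  · exact Or.inl (hnd.trans hst.lt.le)
  obtain ⟨hgap, x₀, y₀, hacc, hd₀⟩ := h.exists_acceptable hS hYS hP hnd
  obtain ⟨t, htc, ht⟩ := hP.resolve_left hnd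
  obtain ⟨-, x, y, ha, hmax, rfl⟩ := hst
  refine Or.inr ⟨t + I.c x, ?_, gap_exchange_le hgap ht ?_⟩
  · have := ha.1.cost_exchange_le
    linarith
  · have hd := hd₀.trans (hmax x₀ y₀ hacc)
    have hg := I.density_pos_iff.1 ha.2.2.1
    rcases eq_or_ne (I.c x) 0 with hc | hc
    · rw [hc, mul_zero]
      exact hg.le
    · have hc' : 0 < I.c x := lt_of_le_of_ne (I.c_nonneg x) (Ne.symm hc)
      rw [density, if_neg hc, EReal.coe_le_coe_iff, le_div_iff₀ hc'] at hd
      exact hd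

/-- Optimality of T keeps Y unrefuted, so the run can only end for lack of an acceptable swap, and
then the ratio has been reached. -/
theorem runResult_le (h : I.RightGuess ε T Y) {S : Finset (Fin n)}
    (hS : I.RunResult ε Y S) : (1 - Real.exp (-2)) / 2 * I.f T ≤ I.f S := by
  have hY : I.Feasible Y :=
    ⟨h.feasible.1.subset (by exact_mod_cast h.subset),
      (I.cost_mono h.subset).trans h.feasible.2⟩
  obtain ⟨hrun, hend⟩ := hS
  have hinv : I.Feasible S ∧ Y ⊆ S ∧ Progress I ε T Y S := by
    clear hend
    induction hrun with
    | refl =>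
      refine ⟨hY, subset_rfl, Or.inr ⟨0, by simp, ?_⟩⟩
      simp [gap]
    | tail _ hst ih =>
      exact ⟨hst.feasible, hst.subset ih.2.1, Progress.step h ih.1 ih.2.1 ih.2.2 hst⟩
  obtain ⟨hf, hYS, hP⟩ := hinv
  by_contra hnd
  obtain ⟨-, x₀, y₀, hacc, -⟩ := h.exists_acceptable hf hYS hP hnd
  let A : Finset (Fin n × Option (Fin n)) :=
    @Finset.filter _ (fun q => I.Acceptable ε Y S q.1 q.2) (Classical.decPred _) Finset.univ
  obtain ⟨q, hq, hmax⟩ := A.exists_max_image (fun q => I.density S q.1 q.2)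
    ⟨(x₀, y₀), by simp [A, hacc]⟩
  refine hend (exchange S q.1 q.2) ⟨?_, q.1, q.2, by simpa [A] using hq, ?_, rfl⟩
  · exact not_lt.2 ((h.optimal S hf).trans h.le_mul)
  · intro x' y' h'
    exact hmax (x', y') (by simp [A, h'])

end RightGuess

/-- Every output of the modified algorithm is a `(1 - e ^ (-2)) / 2`-approximation. -/
theorem Output.isApprox {I : Problem n} {ε : ℝ} (hε : 0 < ε) (hε' : ε ≤ Real.exp (-2))
    {S : Finset (Fin n)} (hS : I.Output ε S) : I.IsApprox ((1 - Real.exp (-2)) / 2) S := by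
  obtain ⟨result, hres, hout, hsmall, hle⟩ := hS
  have hα : (1 - Real.exp (-2)) / 2 ≤ 1 := by linarith [Real.exp_pos (-2)]
  have hfeas : I.Feasible S := by
    rcases hout with h | ⟨Y, hY, hYf, rfl⟩
    · exact h.2
    · exact (hres Y hY hYf).feasible hYf
  refine ⟨hfeas, ?_⟩
  let A : Finset (Finset (Fin n)) := @Finset.filter _ I.Feasible (Classical.decPred _) Finset.univ
  obtain ⟨T, hT, hmax⟩ := A.exists_max_image I.f ⟨S, by simp [A, hfeas]⟩
  have hTf : I.Feasible T := by simpa [A] using hT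
  have hopt : ∀ R, I.Feasible R → I.f R ≤ I.f T := fun R hR => hmax R (by simp [A, hR])
  suffices hsuff : (1 - Real.exp (-2)) / 2 * I.f T ≤ I.f S by
    intro R hR
    have : 0 ≤ (1 - Real.exp (-2)) / 2 := by
      have : Real.exp (-2) ≤ 1 := Real.exp_le_one_iff.2 (by norm_num)
      linarith
    exact (mul_le_mul_of_nonneg_left (hopt R hR) this).trans hsuff
  rcases Nat.lt_or_ge T.card 2 with hc | hc
  · have := hsmall T (by omega) hTf
    nlinarith [I.f_nonneg T]
  · obtain ⟨Y, hYT, hYc, hle', hmarg⟩ := I.exists_greedy_pair hc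
    have hn : 2 ≤ n := hc.trans ((Finset.card_le_univ _).trans_eq (by simp))
    have hg : I.RightGuess ε T Y := ⟨hTf, hopt, hYT, hn, hle', hmarg, hε, hε'⟩
    have hY : I.Feasible Y :=
      ⟨hTf.1.subset (by exact_mod_cast hYT), (I.cost_mono hYT).trans hTf.2⟩
    exact (hg.runResult_le (hres Y hYc hY)).trans (hle Y hYc hY)

end Problem
namespace Problem

variable {n : ℕ} {I : Problem n}

/-! ### The number of swaps -/

/-- The number of swaps after which a run of the modified algorithm has ended. -/
noncomputable def maxSwaps (ε : ℝ) (n : ℕ) : ℕ :=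
  n + ⌊2 * (n : ℝ) ^ 2 / ε * Real.log n⌋₊ + 1

/-- `S` is reached from `Y` by `m` swaps. -/
def ReachedIn (I : Problem n) (ε : ℝ) (Y S : Finset (Fin n)) (m : ℕ) : Prop :=
  Relation.ReflTransGen (I.Step ε Y) Y S ∧ (0 < m → I.f Y < I.f S) ∧
    ∃ i j, i + j = m ∧ Y.card + i ≤ S.card ∧ (1 + ε / (n : ℝ) ^ 2) ^ j * I.f Y ≤ I.f S

theorem reachedIn_zero (I : Problem n) (ε : ℝ) (Y : Finset (Fin n)) : I.ReachedIn ε Y Y 0 :=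
  ⟨Relation.ReflTransGen.refl, fun h => absurd h (lt_irrefl 0), 0, 0, rfl, le_rfl, by simp⟩

/-- An insertion without removal raises the cardinality and is counted by i; a replacement keeps it,
passes the threshold and is counted by j. -/
theorem ReachedIn.step {ε : ℝ} (hε : 0 ≤ ε) {Y S S' : Finset (Fin n)} {m : ℕ}
    (h : I.ReachedIn ε Y S m) (hst : I.Step ε Y S S') : I.ReachedIn ε Y S' (m + 1) := by
  obtain ⟨hr, hlt, i, j, hij, hc, hf⟩ := h
  refine ⟨hr.tail hst, fun _ => ?_, ?_⟩
  · refine lt_of_le_of_lt ?_ hst.lt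
    rcases Nat.eq_zero_or_pos m with h0 | h0
    · obtain ⟨rfl, rfl⟩ : i = 0 ∧ j = 0 := by omega
      simpa using hf
    · exact (hlt h0).le
  · have hlt' := hst.lt
    obtain ⟨-, x, y, ha, -, rfl⟩ := hst
    have hxS := ha.1.1
    cases y with
    | none =>
      refine ⟨i + 1, j, by omega, ?_, hf.trans hlt'.le⟩
      rw [exchange, Finset.card_insert_of_notMem hxS]
      omega
    | some y =>
      have hyS := ha.1.2.1 y rfl
      refine ⟨i, j + 1, by omega, ?_, ?_⟩
      · rw [exchange, Finset.card_insert_of_notMem fun h => hxS (Finset.mem_of_mem_erase h),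
          Finset.card_erase_of_mem hyS]
        have := Finset.card_pos.2 ⟨y, hyS⟩
        omega
      · refine le_trans ?_ (ha.2.2.2.2 (by simp))
        have hδ : 0 ≤ 1 + ε / (n : ℝ) ^ 2 := by positivity
        calc _ = (1 + ε / (n : ℝ) ^ 2) * ((1 + ε / (n : ℝ) ^ 2) ^ j * I.f Y) := by ring
          _ ≤ _ := mul_le_mul_of_nonneg_left hf hδ

theorem ReachedIn.lt_maxSwaps {ε : ℝ} (hε : 0 < ε) (hε' : ε ≤ 1) {Y S : Finset (Fin n)} {m : ℕ}
    (h : I.ReachedIn ε Y S m) (hY : Y.card = 2) (hS : ¬ I.Refutes S Y) :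
    m < maxSwaps ε n := by
  obtain ⟨-, hlt, i, j, hij, hc, hf⟩ := h
  have hSn : S.card ≤ n := (Finset.card_le_univ _).trans_eq (by simp)
  have hn2 : 2 ≤ n := by omega
  have hn : (2 : ℝ) ≤ n := by exact_mod_cast hn2
  have hS' : I.f S ≤ n / 2 * I.f Y := not_lt.1 hS
  unfold maxSwaps
  -- If f(Y) = 0, multiplicative growth says nothing, but a single swap makes f positive and thereby
  -- refutes Y.
  rcases (I.f_nonneg Y).eq_or_lt with h0 | h0
  · have : ¬ 0 < m := by
      intro hm
      have := hlt hm
      rw [← h0] at hS' this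
      linarith
    omega
  · suffices hj : j ≤ ⌊2 * (n : ℝ) ^ 2 / ε * Real.log n⌋₊ by omega
    apply Nat.le_floor
    set δ : ℝ := ε / (n : ℝ) ^ 2 with hδ
    have hδ0 : 0 < δ := by positivity
    have hδ1 : δ ≤ 1 := by
      rw [hδ, div_le_one (by positivity)]
      nlinarith
    have hpow : (1 + δ) ^ j ≤ n := by
      have h1 : (1 + δ) ^ j * I.f Y ≤ n / 2 * I.f Y := hf.trans hS'
      have h2 := le_of_mul_le_mul_right h1 h0
      linarith
    have hlog : j * Real.log (1 + δ) ≤ Real.log n := by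
      rw [← Real.log_pow]
      exact Real.log_le_log (by positivity) hpow
    -- log(1 + δ) ≥ δ/(1 + δ) ≥ δ/2 as δ ≤ 1; this is the 2 in `maxSwaps`.
    have hlow : δ / 2 ≤ Real.log (1 + δ) := by
      have h1 := Real.one_sub_inv_le_log_of_pos (x := 1 + δ) (by positivity)
      have h2 : δ / 2 ≤ 1 - (1 + δ)⁻¹ := by
        rw [div_le_iff₀ two_pos, ← sub_nonneg]
        have : (1 - (1 + δ)⁻¹) * 2 - δ = δ * (1 - δ) / (1 + δ) := by
          field_simp
          ring
        rw [this]
        exact div_nonneg (mul_nonneg hδ0.le (by linarith)) (by positivity)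
      exact h2.trans h1
    have h3 : j * (δ / 2) ≤ Real.log n :=
      (mul_le_mul_of_nonneg_left hlow (Nat.cast_nonneg j)).trans hlog
    have h4 : (j : ℝ) = 2 * (n : ℝ) ^ 2 / ε * (j * (δ / 2)) := by
      rw [hδ]
      field_simp
    rw [h4]
    exact mul_le_mul_of_nonneg_left h3 (by positivity)

end Problem

/-! ### Verification of programs -/

section Registers

variable {n : ℕ} (σ : State n) (i j v : ℕ) (r : ℝ) (A : Finset (Fin n))

@[simp] theorem State.setNat_nat : (σ.setNat i v).nat j = if j = i then v else σ.nat j := by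
  simp [State.setNat, Function.update_apply]

@[simp] theorem State.setNat_real : (σ.setNat i v).real = σ.real := rfl

@[simp] theorem State.setNat_set : (σ.setNat i v).set = σ.set := rfl

@[simp] theorem State.setReal_nat : (σ.setReal i r).nat = σ.nat := rfl

@[simp] theorem State.setReal_real :
    (σ.setReal i r).real j = if j = i then r else σ.real j := by
  simp [State.setReal, Function.update_apply]

@[simp] theorem State.setReal_set : (σ.setReal i r).set = σ.set := rfl

@[simp] theorem State.setSet_nat : (σ.setSet i A).nat = σ.nat := rfl

@[simp] theorem State.setSet_real : (σ.setSet i A).real = σ.real := rfl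

@[simp] theorem State.setSet_set : (σ.setSet i A).set j = if j = i then A else σ.set j := by
  simp [State.setSet, Function.update_apply]

theorem State.setSet_self : σ.setSet i (σ.set i) = σ := by
  simp [State.setSet]

end Registers

/-- Insert the element with the number `k`, if there is one. -/
def addElem {n : ℕ} (S : Finset (Fin n)) (k : ℕ) : Finset (Fin n) :=
  if h : k < n then insert ⟨k, h⟩ S else S

/-- Remove the element with the number `k`, if there is one. -/
def delElem {n : ℕ} (S : Finset (Fin n)) (k : ℕ) : Finset (Fin n) :=
  if h : k < n then S.erase ⟨k, h⟩ else S

/-- The size of the element with the number `k`, or `0`. -/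
noncomputable def Problem.size {n : ℕ} (I : Problem n) (k : ℕ) : ℝ :=
  if h : k < n then I.c ⟨k, h⟩ else 0

theorem apply_putElem {n : ℕ} (I : Problem n) (σ : State n) (s j : ℕ) :
    (Instr.putElem s j).apply I σ = σ.setSet s (addElem (σ.set s) (σ.nat j)) := by
  simp only [Instr.apply, addElem]
  split_ifs
  · rfl
  · exact (σ.setSet_self s).symm

theorem apply_dropElem {n : ℕ} (I : Problem n) (σ : State n) (s j : ℕ) :
    (Instr.dropElem s j).apply I σ = σ.setSet s (delElem (σ.set s) (σ.nat j)) := by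
  simp only [Instr.apply, delElem]
  split_ifs
  · rfl
  · exact (σ.setSet_self s).symm

theorem apply_readSize {n : ℕ} (I : Problem n) (σ : State n) (i j : ℕ) :
    (Instr.readSize i j).apply I σ = σ.setReal i (I.size (σ.nat j)) := rfl

/-- Started in `σ`, the program halts within `T` steps in a state satisfying `Q`. -/
def Wp {n : ℕ} (I : Problem n) (p : Prog) (T : ℕ) (Q : State n → Prop) (σ : State n) : Prop :=
  ∃ τ t, Exec I p σ τ t ∧ t ≤ T ∧ Q τ

/-- The effect of a list of instructions. -/
noncomputable def applyAll {n : ℕ} (I : Problem n) (l : List Instr) (σ : State n) : State n :=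
  l.foldl (fun σ a => a.apply I σ) σ

/-- A list of instructions followed by a program. -/
def block (l : List Instr) (p : Prog) : Prog :=
  l.foldr (fun a q => .seq (.instr a) q) p

/-- `for i := 0 to N - 1 do body`, where `N` is the content of register `b`. -/
def forUpto (i b : ℕ) (body : Prog) : Prog :=
  .seq (.instr (.natConst i 0)) (.loop (.natLt i b) (.seq body (.instr (.natSucc i))))

/-! ### Proof rules for total correctness with a time bound -/

section Rules

variable {n : ℕ} {I : Problem n} {σ : State n} {p q : Prog} {P Q : State n → Prop} {T T' : ℕ}

theorem Wp.mono (h : Wp I p T P σ) (hT : T ≤ T') (hPQ : ∀ τ, P τ → Q τ) : Wp I p T' Q σ := by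
  obtain ⟨τ, t, h1, h2, h3⟩ := h
  exact ⟨τ, t, h1, h2.trans hT, hPQ τ h3⟩

theorem wp_skip (h : Q σ) : Wp I .skip T Q σ := ⟨σ, 0, .skip σ, Nat.zero_le _, h⟩

theorem wp_seq (h : Wp I p T (fun τ => Wp I q T' Q τ) σ) : Wp I (.seq p q) (T + T') Q σ := by
  obtain ⟨τ, s, h1, h2, υ, t, h3, h4, h5⟩ := h
  exact ⟨υ, s + t, .seq h1 h3, Nat.add_le_add h2 h4, h5⟩

theorem wp_branch {b : Cond} (hp : b.Holds I σ → Wp I p T Q σ)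
    (hq : ¬ b.Holds I σ → Wp I q T Q σ) : Wp I (.branch b p q) (T + 1) Q σ := by
  by_cases hb : b.Holds I σ
  · obtain ⟨τ, t, h1, h2, h3⟩ := hp hb
    exact ⟨τ, t + 1, .branchTrue hb h1, Nat.add_le_add_right h2 1, h3⟩
  · obtain ⟨τ, t, h1, h2, h3⟩ := hq hb
    exact ⟨τ, t + 1, .branchFalse hb h1, Nat.add_le_add_right h2 1, h3⟩

theorem wp_block {l : List Instr} (h : Wp I p T Q (applyAll I l σ)) :
    Wp I (block l p) (l.length + T) Q σ := by
  induction l generalizing σ with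
  | nil => simpa [block, applyAll] using h
  | cons a l ih =>
    obtain ⟨τ, t, h1, h2, h3⟩ := ih (σ := a.apply I σ) (by simpa [applyAll] using h)
    refine ⟨τ, 1 + t, .seq (.instr a σ) h1, ?_, h3⟩
    rw [List.length_cons]
    omega

/-- A loop with a bound on the number of its iterations. -/
theorem wp_loop {b : Cond} {Inv : ℕ → State n → Prop} {K : ℕ} (h0 : Inv K σ)
    (hstep : ∀ k σ, Inv k σ → b.Holds I σ → ∃ k', k = k' + 1 ∧ Wp I p T (Inv k') σ) :
    Wp I (.loop b p) (K * (T + 1) + 1) (fun τ => ¬ b.Holds I τ ∧ ∃ k, Inv k τ) σ := by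
  induction K generalizing σ with
  | zero =>
    have hb : ¬ b.Holds I σ := by
      intro hb
      obtain ⟨k', hk, -⟩ := hstep 0 σ h0 hb
      omega
    exact ⟨σ, 1, .loopFalse hb, by omega, hb, 0, h0⟩
  | succ K ih =>
    by_cases hb : b.Holds I σ
    · obtain ⟨k', hk, τ, s, h1, h2, h3⟩ := hstep _ σ h0 hb
      obtain rfl : k' = K := by omega
      obtain ⟨υ, t, h4, h5, h6⟩ := ih h3
      refine ⟨υ, s + t + 1, .loopTrue hb h1 h4, ?_, h6⟩
      rw [Nat.succ_mul]
      omega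
    · exact ⟨σ, 1, .loopFalse hb, by omega, hb, _, h0⟩

/-- Each round adds the test and the increment to the body; the final 2 is the initialization and
the failing test. -/
theorem wp_forUpto {i b N : ℕ} {Inv : ℕ → State n → Prop} (h0 : Inv 0 (σ.setNat i 0))
    (hreg : ∀ k σ, Inv k σ → σ.nat i = k ∧ σ.nat b = N)
    (hbody : ∀ k < N, ∀ σ, Inv k σ → Wp I p T (fun τ => Inv (k + 1) (τ.setNat i (τ.nat i + 1))) σ) :
    Wp I (forUpto i b p) (N * (T + 2) + 2) (Inv N) σ := by
  have hl : Wp I (.loop (.natLt i b) (.seq p (.instr (.natSucc i)))) (N * (T + 2) + 1)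
      (fun τ => ¬ (Cond.natLt i b).Holds I τ ∧ ∃ k, ∃ m ≤ N, m + k = N ∧ Inv m τ)
      (σ.setNat i 0) := by
    refine wp_loop (Inv := fun k τ => ∃ m ≤ N, m + k = N ∧ Inv m τ) ⟨0, Nat.zero_le _, by omega, h0⟩ ?_
    rintro k τ ⟨m, hm, hmk, hI⟩ hb
    obtain ⟨h1, h2⟩ := hreg m τ hI
    have hb' : m < N := by
      change τ.nat i < τ.nat b at hb
      omega
    refine ⟨k - 1, by omega, wp_seq ((hbody m hb' τ hI).mono le_rfl fun υ hυ => ?_)⟩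
    exact ⟨_, 1, .instr _ _, le_rfl, m + 1, by omega, by omega, hυ⟩
  obtain ⟨τ, t, h1, h2, h3, k, m, hm, hmk, h4⟩ := hl
  obtain ⟨h5, h6⟩ := hreg m τ h4
  have : m = N := by
    change ¬ τ.nat i < τ.nat b at h3
    omega
  subst this
  exact ⟨τ, 1 + t, .seq (.instr _ _) h1, by omega, h4⟩

end Rules

section Instructions

variable {n : ℕ} (I : Problem n) (σ : State n) (i j k : ℕ) (q : ℚ)

@[simp] theorem apply_natConst : (Instr.natConst i k).apply I σ = σ.setNat i k := rfl

@[simp] theorem apply_natCopy : (Instr.natCopy i j).apply I σ = σ.setNat i (σ.nat j) := rfl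

@[simp] theorem apply_natSucc : (Instr.natSucc i).apply I σ = σ.setNat i (σ.nat i + 1) := rfl

@[simp] theorem apply_groundCard : (Instr.groundCard i).apply I σ = σ.setNat i n := rfl

@[simp] theorem apply_realConst : (Instr.realConst i q).apply I σ = σ.setReal i (q : ℝ) := rfl

@[simp] theorem apply_realCopy : (Instr.realCopy i j).apply I σ = σ.setReal i (σ.real j) := rfl

@[simp] theorem apply_realOfNat :
    (Instr.realOfNat i j).apply I σ = σ.setReal i (σ.nat j : ℝ) := rfl

@[simp] theorem apply_realAdd :
    (Instr.realAdd i j k).apply I σ = σ.setReal i (σ.real j + σ.real k) := rfl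

@[simp] theorem apply_realSub :
    (Instr.realSub i j k).apply I σ = σ.setReal i (σ.real j - σ.real k) := rfl

@[simp] theorem apply_realMul :
    (Instr.realMul i j k).apply I σ = σ.setReal i (σ.real j * σ.real k) := rfl

@[simp] theorem apply_realDiv :
    (Instr.realDiv i j k).apply I σ = σ.setReal i (σ.real j / σ.real k) := rfl

@[simp] theorem apply_readBound : (Instr.readBound i).apply I σ = σ.setReal i I.B := rfl

@[simp] theorem apply_askValue :
    (Instr.askValue i j).apply I σ = σ.setReal i (I.f (σ.set j)) := rfl

end Instructions

attribute [simp] apply_putElem apply_dropElem apply_readSize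

/-! ### The best swap found so far -/

/-- The option with the number `k`; numbers from `n` on stand for the dummy element. -/
def ofNumber (n k : ℕ) : Option (Fin n) := if h : k < n then some ⟨k, h⟩ else none

/-- The number of an option. -/
def number {n : ℕ} : Option (Fin n) → ℕ
  | none => n
  | some z => z

theorem ofNumber_number {n : ℕ} (y : Option (Fin n)) : ofNumber n (number y) = y := by
  cases y <;> simp [ofNumber, number]

theorem number_le {n : ℕ} (y : Option (Fin n)) : number y ≤ n := by
  cases y with
  | none => exact le_rfl
  | some z => exact z.2.le

theorem addElem_delElem {n : ℕ} (S : Finset (Fin n)) (x : Fin n) (k : ℕ) :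
    addElem (delElem S k) x = exchange S x (ofNumber n k) := by
  by_cases h : k < n <;> simp [addElem, delElem, ofNumber, exchange, h]

theorem addElem_delElem_exchange {n : ℕ} {S : Finset (Fin n)} {x : Fin n} {k : ℕ} (hx : x ∉ S)
    (hk : ∀ h : k < n, ⟨k, h⟩ ∈ S) : addElem (delElem (exchange S x (ofNumber n k)) x) k = S := by
  by_cases h : k < n
  · have hx' : x ∉ S.erase ⟨k, h⟩ := fun h' => hx (Finset.mem_of_mem_erase h')
    simp [addElem, delElem, ofNumber, exchange, h, Finset.erase_insert hx',
      Finset.insert_erase (hk h)]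
  · simp [addElem, delElem, ofNumber, exchange, h, Finset.erase_insert hx]

open Classical in
/-- The density of a swap with gain `g` that inserts an element of size `c`. -/
noncomputable def dens (g c : ℝ) : EReal :=
  if c = 0 then (if 0 < g then ⊤ else 0) else ((g / c : ℝ) : EReal)

/-- Cross-multiplication compares densities without handling +∞. It would fail for g = c = 0, so the
density 0 of "no swap yet" is represented by g = 0, c = 1. -/
theorem dens_lt_dens_iff {g c g' c' : ℝ} (h : g = 0 ∧ c = 1 ∨ 0 < g ∧ 0 ≤ c) (hc' : 0 ≤ c') :
    dens g c < dens g' c' ↔ g * c' < g' * c := by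
  unfold dens
  rcases h with ⟨rfl, rfl⟩ | ⟨hg, hc⟩
  · rcases hc'.eq_or_lt with rfl | hc'
    · by_cases hg' : 0 < g' <;> simp [hg']
    · simp [hc'.ne', div_pos_iff_of_pos_right hc']
  · rcases hc.eq_or_lt with rfl | hc
    · simp [hg, mul_nonneg hg.le hc']
    · rcases hc'.eq_or_lt with rfl | hc'
      · by_cases hg' : 0 < g'
        · simp [hg', hc.ne', hc]
        · have h1 : ¬ ((g / c : ℝ) : EReal) < 0 := by
            rw [not_lt]
            exact_mod_cast (div_pos hg hc).le
          have h2 : ¬ 0 < g' * c := by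
            rw [not_lt]
            exact mul_nonpos_of_nonpos_of_nonneg (not_lt.1 hg') hc.le
          simp [hg', hc.ne', h1, h2]
      · simp [hc.ne', hc'.ne', div_lt_div_iff₀ hc hc']

namespace Problem

variable {n : ℕ}

theorem density_eq_dens (I : Problem n) (S : Finset (Fin n)) (x : Fin n) (y : Option (Fin n)) :
    I.density S x y = dens (I.gain S x y) (I.c x) := rfl

/-- The swap passes all tests except that its density may be non-positive. -/
def Tests (I : Problem n) (ε : ℝ) (Y S : Finset (Fin n)) (x : Fin n) (y : Option (Fin n)) :
    Prop :=
  I.IsSwap S x y ∧ (∀ z, y = some z → z ∉ Y) ∧ I.cost (exchange S x y) ≤ I.B ∧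
    (y ≠ none → (1 + ε / (n : ℝ) ^ 2) * I.f S ≤ I.f (exchange S x y))

theorem acceptable_iff {I : Problem n} {ε : ℝ} {Y S : Finset (Fin n)} {x : Fin n}
    {y : Option (Fin n)} :
    I.Acceptable ε Y S x y ↔ I.Tests ε Y S x y ∧ 0 < I.gain S x y := by
  unfold Acceptable Tests
  rw [density_pos_iff]
  tauto

/-- Among the swaps up to those of the element `x` with the first `k` options, the best one has
gain `g` and inserts an element of size `c`; it is the swap with the numbers `a` and `b`. -/
def BestSwap (I : Problem n) (ε : ℝ) (Y S : Finset (Fin n)) (x k : ℕ) (g c : ℝ) (a b : ℕ) :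
    Prop :=
  (∀ x' y', (x'.val < x ∨ x'.val = x ∧ number y' < k) → I.Acceptable ε Y S x' y' →
    I.density S x' y' ≤ dens g c) ∧
  (g = 0 ∧ c = 1 ∨ 0 < g ∧ ∃ h : a < n, I.Acceptable ε Y S ⟨a, h⟩ (ofNumber n b) ∧
    I.gain S ⟨a, h⟩ (ofNumber n b) = g ∧ I.c ⟨a, h⟩ = c)

namespace BestSwap

variable {I : Problem n} {ε : ℝ} {Y S : Finset (Fin n)} {k a b : ℕ} {g c : ℝ}

theorem init (I : Problem n) (ε : ℝ) (Y S : Finset (Fin n)) (a b : ℕ) :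
    I.BestSwap ε Y S 0 0 0 1 a b :=
  ⟨fun _ _ h => by omega, Or.inl ⟨rfl, rfl⟩⟩

theorem good {x : ℕ} (h : I.BestSwap ε Y S x k g c a b) : g = 0 ∧ c = 1 ∨ 0 < g ∧ 0 ≤ c := by
  rcases h.2 with h | ⟨hg, ha, -, -, rfl⟩
  · exact Or.inl h
  · exact Or.inr ⟨hg, I.c_nonneg _⟩

theorem nextElem {x : ℕ} (h : I.BestSwap ε Y S x (n + 1) g c a b) :
    I.BestSwap ε Y S (x + 1) 0 g c a b := by
  refine ⟨fun x' y' h' => h.1 x' y' ?_, h.2⟩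
  have := number_le y'
  omega

theorem skipElem {x : Fin n} (hx : x ∈ S) (h : I.BestSwap ε Y S x 0 g c a b) :
    I.BestSwap ε Y S (x + 1) 0 g c a b := by
  refine ⟨fun x' y' h' ha => h.1 x' y' ?_ ha, h.2⟩
  have hne : x' ≠ x := by
    rintro rfl
    exact ha.1.1 hx
  have : x'.val ≠ x.val := fun h => hne (Fin.ext h)
  omega

theorem keep {x : Fin n} (h : I.BestSwap ε Y S x k g c a b)
    (hn : ¬ (I.Tests ε Y S x (ofNumber n k) ∧
      g * I.c x < I.gain S x (ofNumber n k) * c)) :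
    I.BestSwap ε Y S x (k + 1) g c a b := by
  refine ⟨fun x' y' h' ha => ?_, h.2⟩
  by_cases hb : x'.val < x ∨ x'.val = x ∧ number y' < k
  · exact h.1 x' y' hb ha
  · obtain rfl : x' = x := Fin.ext (by omega)
    have hy : y' = ofNumber n k := by
      rw [← ofNumber_number y']
      congr 1
      omega
    subst hy
    rw [acceptable_iff] at ha
    rw [density_eq_dens, ← not_lt, dens_lt_dens_iff h.good (I.c_nonneg x')]
    exact fun h' => hn ⟨ha.1, h'⟩

theorem replace {x : Fin n} (h : I.BestSwap ε Y S x k g c a b)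
    (ht : I.Tests ε Y S x (ofNumber n k))
    (hlt : g * I.c x < I.gain S x (ofNumber n k) * c) :
    I.BestSwap ε Y S x (k + 1) (I.gain S x (ofNumber n k)) (I.c x) x k := by
  have hgood := h.good
  have hcx := I.c_nonneg x
  have hpos : 0 < I.gain S x (ofNumber n k) := by
    by_contra! hcon
    rcases hgood with ⟨rfl, rfl⟩ | ⟨h1, h2⟩
    · linarith
    · have := mul_nonneg h1.le hcx
      have := mul_nonpos_of_nonpos_of_nonneg hcon h2
      linarith
  have hd := (dens_lt_dens_iff hgood hcx).2 hlt
  refine ⟨fun x' y' h' ha => ?_, Or.inr ⟨hpos, x.2, acceptable_iff.2 ⟨ht, hpos⟩, rfl, rfl⟩⟩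
  by_cases hb : x'.val < x ∨ x'.val = x ∧ number y' < k
  · exact (h.1 x' y' hb ha).trans hd.le
  · obtain rfl : x' = x := Fin.ext (by omega)
    have hy : y' = ofNumber n k := by
      rw [← ofNumber_number y']
      congr 1
      omega
    rw [hy]
    exact le_rfl

theorem not_acceptable (h : I.BestSwap ε Y S n 0 g c a b) (hg : ¬ 0 < g) (x : Fin n)
    (y : Option (Fin n)) : ¬ I.Acceptable ε Y S x y := by
  intro ha
  rcases h.2 with ⟨rfl, rfl⟩ | ⟨hg', -⟩
  · have h1 := h.1 x y (Or.inl x.2) ha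
    have h2 := ha.2.2.1.trans_le h1
    simp [dens] at h2
  · exact hg hg'

theorem greedySwap (h : I.BestSwap ε Y S n 0 g c a b) (hg : 0 < g) :
    ∃ ha : a < n, c = I.c ⟨a, ha⟩ ∧ I.IsSwap S ⟨a, ha⟩ (ofNumber n b) ∧
      I.GreedySwap ε Y S (exchange S ⟨a, ha⟩ (ofNumber n b)) := by
  rcases h.2 with ⟨rfl, -⟩ | ⟨-, ha, hacc, rfl, rfl⟩
  · exact absurd hg (lt_irrefl 0)
  · exact ⟨ha, rfl, hacc.1, _, _, hacc, fun x' y' h' => h.1 x' y' (Or.inl x'.2) h', rfl⟩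

end BestSwap

theorem cost_sub_size_add {I : Problem n} {S : Finset (Fin n)} {x : Fin n} {k : ℕ} (hx : x ∉ S)
    (hk : ∀ h : k < n, ⟨k, h⟩ ∈ S) :
    I.cost S - I.size k + I.c x = I.cost (exchange S x (ofNumber n k)) := by
  by_cases h : k < n
  · simp only [size, ofNumber, h, dif_pos, I.cost_exchange_some hx (hk h)]
  · simp only [size, ofNumber, h, dif_neg, not_false_eq_true, I.cost_exchange_none hx, sub_zero]

end Problem

/-! ### The search for the best swap -/

/-- Compare the swap with the numbers in the number registers `3` and `4` with the best one. -/
def evalSwap : Prog :=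
  block [.dropElem 1 4, .putElem 1 3, .readSize 8 4, .realSub 8 3 8, .realAdd 8 8 7,
    .askValue 9 1, .realSub 10 9 1, .realMul 14 5 7, .realMul 15 10 6] <|
  .seq (.branch (.indep 1) (.branch (.realLe 8 11) (.branch (.realLe 17 9)
      (.branch (.realLt 14 15)
        (block [.realCopy 5 10, .realCopy 6 7, .natCopy 5 3, .natCopy 6 4] .skip)
      .skip) .skip) .skip) .skip)
    (block [.dropElem 1 3, .putElem 1 4] .skip)

/-- The same, after a test whether the numbers name a swap that keeps the guess. -/
def trySwap : Prog :=
  .branch (.natEq 4 0) (block [.realConst 17 0] evalSwap)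
    (.branch (.mem 1 4) (.branch (.mem 2 4) .skip (block [.realCopy 17 4] evalSwap)) .skip)

/-- Consider all swaps that insert the element with the number in number register `3`. -/
def tryElem : Prog :=
  .branch (.mem 1 3) .skip (block [.readSize 7 3] (forUpto 4 10 trySwap))

/-- Find the best swap. -/
def searchSwap : Prog :=
  block [.realMul 4 12 1, .realConst 5 0, .realConst 6 1] (forUpto 3 0 tryElem)

/-! ### Register invariants of the search -/

namespace Problem

variable {n : ℕ}

/-- The registers with global data: `u` and `v` are the elements of the guess, and `O` is the best
solution found in earlier runs. -/
def GlobalRegs (I : Problem n) (ε : ℝ) (u v : ℕ) (O : Finset (Fin n)) (σ : State n) : Prop :=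
  (σ.nat 0 = n ∧ σ.nat 9 = 0 ∧ σ.nat 10 = n + 1 ∧ σ.nat 1 = u ∧ σ.nat 2 = v) ∧
    (σ.real 11 = I.B ∧ σ.real 12 = 1 + ε / (n : ℝ) ^ 2 ∧ σ.real 16 = n / 2) ∧
    σ.real 0 = I.f O ∧ σ.set 0 = O

theorem GlobalRegs.congr {I : Problem n} {ε : ℝ} {u v : ℕ} {O : Finset (Fin n)} {σ τ : State n}
    (h : I.GlobalRegs ε u v O σ) (hn : ∀ i ∈ [0, 9, 10, 1, 2], τ.nat i = σ.nat i)
    (hr : ∀ i ∈ [11, 12, 16, 0], τ.real i = σ.real i) (hs : τ.set 0 = σ.set 0) :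
    I.GlobalRegs ε u v O τ := by
  simp only [List.forall_mem_cons] at hn hr
  simpa only [GlobalRegs, hn, hr, hs] using h

/-- The registers with the data of a run. -/
def RunRegs (I : Problem n) (Y : Finset (Fin n)) (σ : State n) : Prop :=
  σ.set 2 = Y ∧ σ.real 13 = n / 2 * I.f Y

theorem RunRegs.congr {I : Problem n} {Y : Finset (Fin n)} {σ τ : State n}
    (h : I.RunRegs Y σ) (hr : τ.real 13 = σ.real 13) (hs : τ.set 2 = σ.set 2) :
    I.RunRegs Y τ := by
  simpa only [RunRegs, hr, hs] using h

/-- The registers with the data of the current solution `S`, apart from `S` itself. -/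
def SolutionRegs (I : Problem n) (S : Finset (Fin n)) (σ : State n) : Prop :=
  σ.real 1 = I.f S ∧ σ.real 3 = I.cost S ∧ σ.nat 7 = 1

theorem SolutionRegs.congr {I : Problem n} {S : Finset (Fin n)} {σ τ : State n}
    (h : I.SolutionRegs S σ) (hr : ∀ i ∈ [1, 3], τ.real i = σ.real i)
    (hn : τ.nat 7 = σ.nat 7) : I.SolutionRegs S τ := by
  simp only [List.forall_mem_cons] at hr
  simpa only [SolutionRegs, hn, hr] using h

/-- The registers that are constant during the search for a swap. -/
def SearchRegs (I : Problem n) (ε : ℝ) (u v : ℕ) (O Y S : Finset (Fin n)) (σ : State n) : Prop :=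
  I.GlobalRegs ε u v O σ ∧ I.RunRegs Y σ ∧ I.SolutionRegs S σ ∧
    σ.real 4 = (1 + ε / (n : ℝ) ^ 2) * I.f S

theorem SearchRegs.congr {I : Problem n} {ε : ℝ} {u v : ℕ} {O Y S : Finset (Fin n)}
    {σ τ : State n} (h : I.SearchRegs ε u v O Y S σ)
    (hn : ∀ i ∈ [0, 9, 10, 1, 2, 7], τ.nat i = σ.nat i)
    (hr : ∀ i ∈ [11, 12, 16, 0, 13, 1, 3, 4], τ.real i = σ.real i) (h0 : τ.set 0 = σ.set 0)
    (h2 : τ.set 2 = σ.set 2) : I.SearchRegs ε u v O Y S τ := by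
  simp only [List.forall_mem_cons] at hn hr
  refine ⟨h.1.congr ?_ ?_ h0, h.2.1.congr ?_ h2, h.2.2.1.congr ?_ ?_, ?_⟩
  · simp [hn]
  · simp [hr]
  · simp [hr]
  · simp [hr]
  · simp [hn]
  · simp [hr, h.2.2.2]

/-- The state of the search after the swaps of the element `x` with the first `k` options; `A` is
the content of the working set. -/
def OptionInv (I : Problem n) (ε : ℝ) (u v : ℕ) (O Y S A : Finset (Fin n)) (x : Fin n) (i k : ℕ)
    (σ : State n) : Prop :=
  I.SearchRegs ε u v O Y S σ ∧ σ.set 1 = A ∧ σ.nat 3 = x ∧ σ.nat 4 = i ∧ σ.real 7 = I.c x ∧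
    I.BestSwap ε Y S x k (σ.real 5) (σ.real 6) (σ.nat 5) (σ.nat 6)

variable {I : Problem n} {ε : ℝ} {u v : ℕ} {O Y S : Finset (Fin n)}

theorem OptionInv.next {x : Fin n} {k : ℕ} {σ : State n}
    (h : I.OptionInv ε u v O Y S S x k (k + 1) σ) :
    I.OptionInv ε u v O Y S S x (k + 1) (k + 1) (σ.setNat 4 (σ.nat 4 + 1)) := by
  obtain ⟨h1, h2, h3, h4, h5, h6⟩ := h
  exact ⟨h1.congr (by simp) (by simp) rfl rfl, h2, by simpa using h3, by simp [h4], h5, by simpa using h6⟩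

/-- The exchange is made in place and then undone, so no set is copied and the time is constant. The
dummy has the number n, for which element operations do nothing and the size reads as 0. -/
theorem wp_evalSwap {x : Fin n} {k : ℕ} (hx : x ∉ S)
    (hk : ∀ h : k < n, (⟨k, h⟩ : Fin n) ∈ S ∧ (⟨k, h⟩ : Fin n) ∉ Y) {σ : State n}
    (hσ : I.OptionInv ε u v O Y S S x k k σ)
    (ht : σ.real 17 = if k < n then (1 + ε / (n : ℝ) ^ 2) * I.f S else 0) :
    Wp I evalSwap 19 (I.OptionInv ε u v O Y S S x k (k + 1)) σ := by
  have hkS : ∀ h : k < n, (⟨k, h⟩ : Fin n) ∈ S := fun h => (hk h).1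
  obtain ⟨h1, h2, h3, h4, h5, h6⟩ := hσ
  refine (wp_block (T := 10) (wp_seq (T := 8) (T' := 2) ?_)).mono (by decide) fun _ h => h
  obtain ⟨σ', hσ'⟩ : ∃ σ', σ' = applyAll I [.dropElem 1 4, .putElem 1 3, .readSize 8 4,
    .realSub 8 3 8, .realAdd 8 8 7, .askValue 9 1, .realSub 10 9 1, .realMul 14 5 7,
    .realMul 15 10 6] σ := ⟨_, rfl⟩
  rw [← hσ']
  simp only [applyAll, List.foldl_cons, List.foldl_nil] at hσ'
  have e1 : σ'.set 1 = exchange S x (ofNumber n k) := by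
    simp [hσ', h2, h3, h4, addElem_delElem]
  have e8 : σ'.real 8 = I.cost (exchange S x (ofNumber n k)) := by
    simp [hσ', h4, h5, h1.2.2.1.2.1, cost_sub_size_add hx hkS]
  have e9 : σ'.real 9 = I.f (exchange S x (ofNumber n k)) := by
    simp [hσ', h2, h3, h4, addElem_delElem]
  have e10 : σ'.real 10 = I.gain S x (ofNumber n k) := by
    simp [hσ', h2, h3, h4, addElem_delElem, h1.2.2.1.1, gain]
  have e14 : σ'.real 14 = σ.real 5 * I.c x := by simp [hσ', h5]
  have e15 : σ'.real 15 = I.gain S x (ofNumber n k) * σ.real 6 := by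
    simp [hσ', h2, h3, h4, addElem_delElem, h1.2.2.1.1, gain]
  have e17 : σ'.real 17 = σ.real 17 := by simp [hσ']
  have e3 : σ'.nat 3 = x := by simp [hσ', h3]
  have e4 : σ'.nat 4 = k := by simp [hσ', h4]
  have e5 : σ'.nat 5 = σ.nat 5 := by simp [hσ']
  have e6 : σ'.nat 6 = σ.nat 6 := by simp [hσ']
  have e5' : σ'.real 5 = σ.real 5 := by simp [hσ']
  have e6' : σ'.real 6 = σ.real 6 := by simp [hσ']
  have e7' : σ'.real 7 = I.c x := by simp [hσ', h5]
  have hs : I.SearchRegs ε u v O Y S σ' :=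
    h1.congr (by simp [hσ']) (by simp [hσ']) (by simp [hσ']) (by simp [hσ'])
  have e11 : σ'.real 11 = I.B := hs.1.2.1.1
  clear hσ'
  -- For the dummy the threshold is 0, a test that always succeeds since f ≥ 0.
  have htests : I.Tests ε Y S x (ofNumber n k) ↔ I.Indep (σ'.set 1) ∧ σ'.real 8 ≤ σ'.real 11 ∧
      σ'.real 17 ≤ σ'.real 9 := by
    rw [e1, e8, e9, e11, e17, ht]
    unfold Tests IsSwap
    by_cases h : k < n
    · simp [ofNumber, h, hx, hk h]
    · simp [ofNumber, h, hx, I.f_nonneg]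
  have hkeep : ¬ (I.Tests ε Y S x (ofNumber n k) ∧ σ'.real 14 < σ'.real 15) →
      I.OptionInv ε u v O Y S (exchange S x (ofNumber n k)) x k (k + 1) σ' := by
    intro hn
    refine ⟨hs, e1, e3, e4, e7', ?_⟩
    rw [e5, e6, e5', e6']
    exact h6.keep (by rwa [e14, e15] at hn)
  have hmid : Wp I (.branch (.indep 1) (.branch (.realLe 8 11) (.branch (.realLe 17 9)
      (.branch (.realLt 14 15)
        (block [.realCopy 5 10, .realCopy 6 7, .natCopy 5 3, .natCopy 6 4] .skip)
      .skip) .skip) .skip) .skip) 8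
      (I.OptionInv ε u v O Y S (exchange S x (ofNumber n k)) x k (k + 1)) σ' := by
    refine wp_branch (fun c1 => wp_branch (fun c2 => wp_branch (fun c3 => wp_branch (fun c4 => ?_)
      fun c4 => ?_) fun c3 => ?_) fun c2 => ?_) fun c1 => ?_
    · refine (wp_block (T := 0) (wp_skip ?_))
      simp only [applyAll, List.foldl_cons, List.foldl_nil]
      refine ⟨hs.congr (by simp) (by simp) (by simp) (by simp), by simp [e1], by simp [e3],
        by simp [e4], by simp [e7'], ?_⟩
      have hlt : σ'.real 14 < σ'.real 15 := c4
      rw [e14, e15] at hlt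
      simpa [e10, e7', e3, e4] using h6.replace (htests.2 ⟨c1, c2, c3⟩) hlt
    · exact wp_skip (hkeep fun h => c4 h.2)
    · exact wp_skip (hkeep fun h => c3 (htests.1 h.1).2.2)
    · exact wp_skip (hkeep fun h => c2 (htests.1 h.1).2.1)
    · exact wp_skip (hkeep fun h => c1 (htests.1 h.1).1)
  refine hmid.mono le_rfl ?_
  rintro τ ⟨g1, g2, g3, g4, g5, g6⟩
  refine wp_block (T := 0) (wp_skip ?_)
  simp only [applyAll, List.foldl_cons, List.foldl_nil]
  exact ⟨g1.congr (by simp) (by simp) (by simp) (by simp),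
    by simp [g2, g3, g4, addElem_delElem_exchange hx hkS], by simp [g3], by simp [g4],
    by simp [g5], by simpa using g6⟩

theorem wp_trySwap {x : Fin n} {k : ℕ} (hx : x ∉ S) (hkn : k ≤ n) {σ : State n}
    (hσ : I.OptionInv ε u v O Y S S x k k σ) :
    Wp I trySwap 23 (I.OptionInv ε u v O Y S S x k (k + 1)) σ := by
  have hr : ∀ r, I.OptionInv ε u v O Y S S x k k (σ.setReal 17 r) := fun r =>
    ⟨hσ.1.congr (by simp) (by simp) rfl rfl, hσ.2.1, hσ.2.2.1, hσ.2.2.2.1,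
      by simpa using hσ.2.2.2.2.1, by simpa using hσ.2.2.2.2.2⟩
  have h0 : σ.nat 0 = n := hσ.1.1.1.1
  have h4 : σ.nat 4 = k := hσ.2.2.2.1
  have h1 : σ.set 1 = S := hσ.2.1
  have h2 : σ.set 2 = Y := hσ.1.2.1.1
  have hskip : (k < n ∧ ¬ ∃ h : k < n, (⟨k, h⟩ : Fin n) ∈ S ∧ (⟨k, h⟩ : Fin n) ∉ Y) →
      I.OptionInv ε u v O Y S S x k (k + 1) σ := by
    rintro ⟨hlt, hno⟩
    refine ⟨hσ.1, h1, hσ.2.2.1, h4, hσ.2.2.2.2.1, hσ.2.2.2.2.2.keep ?_⟩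
    rintro ⟨ht, -⟩
    have hof : ofNumber n k = some ⟨k, hlt⟩ := by simp [ofNumber, hlt]
    exact hno ⟨hlt, ht.1.2.1 _ hof, ht.2.1 _ hof⟩
  refine wp_branch (fun c => ?_) fun c => wp_branch (fun c1 => wp_branch (fun c2 => wp_skip ?_)
    fun c2 => ?_) fun c1 => wp_skip ?_
  · have hk : k = n := by
      have : σ.nat 4 = σ.nat 0 := c
      omega
    refine (wp_block (T := 19) (wp_evalSwap (σ := σ.setReal 17 ((0 : ℚ) : ℝ)) hx
      (fun h => by omega) (hr _) (by simp [hk]))).mono (by decide) fun _ h => h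
  · refine hskip ⟨?_, ?_⟩
    · have : ¬ σ.nat 4 = σ.nat 0 := c
      omega
    · rintro ⟨h, -, h'⟩
      obtain ⟨g, hg⟩ := c2
      simp only [h4, h2] at hg
      exact h' hg
  · obtain ⟨g, hg⟩ := c1
    simp only [h4, h1] at hg
    rw [h4] at g
    have hgY : (⟨k, g⟩ : Fin n) ∉ Y := by
      intro hY
      refine c2 ⟨by rw [h4]; exact g, ?_⟩
      simp only [h4, h2]
      exact hY
    refine (wp_block (T := 19) (wp_evalSwap (σ := σ.setReal 17 (σ.real 4)) hx
      (fun h => ⟨hg, hgY⟩) (hr _) (by simp [g, hσ.1.2.2.2]))).mono (by decide) fun _ h => h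
  · refine hskip ⟨?_, ?_⟩
    · have : ¬ σ.nat 4 = σ.nat 0 := c
      omega
    · rintro ⟨h, h', -⟩
      refine c1 ⟨by rw [h4]; exact h, ?_⟩
      simp only [h4, h1]
      exact h'

/-- The state of the search after the swaps that insert one of the first `x` elements. -/
def ElemInv (I : Problem n) (ε : ℝ) (u v : ℕ) (O Y S : Finset (Fin n)) (i x : ℕ) (σ : State n) :
    Prop :=
  I.SearchRegs ε u v O Y S σ ∧ σ.set 1 = S ∧ σ.nat 3 = i ∧
    I.BestSwap ε Y S x 0 (σ.real 5) (σ.real 6) (σ.nat 5) (σ.nat 6)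

theorem wp_tryElem {x : Fin n} {σ : State n} (hσ : I.ElemInv ε u v O Y S x x σ) :
    Wp I tryElem ((n + 1) * 25 + 4) (I.ElemInv ε u v O Y S x (x + 1)) σ := by
  obtain ⟨h1, h2, h3, h4⟩ := hσ
  refine wp_branch (T := (n + 1) * 25 + 3) (fun c => wp_skip ?_) fun c => ?_
  · obtain ⟨g, hg⟩ := c
    simp only [h2, h3] at hg
    exact ⟨h1, h2, h3, h4.skipElem hg⟩
  · have hx : x ∉ S := by
      intro hx
      refine c ⟨by rw [h3]; exact x.2, ?_⟩
      simp only [h2, h3]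
      exact hx
    have hsize : I.size x = I.c x := by simp [size]
    -- There are n + 1 options: the n elements and the dummy.
    refine (wp_block (T := (n + 1) * 25 + 2) ((wp_forUpto (N := n + 1) (T := 23)
      (Inv := fun k τ => I.OptionInv ε u v O Y S S x k k τ) ?_ ?_ ?_).mono le_rfl ?_)).mono
      (by simp; omega) fun _ h => h
    · simp only [applyAll, List.foldl_cons, List.foldl_nil]
      exact ⟨h1.congr (by simp) (by simp) rfl rfl, h2, by simpa using h3, by simp,
        by simp [h3, hsize], by simpa using h4⟩
    · exact fun k τ hτ => ⟨hτ.2.2.2.1, hτ.1.1.1.2.2.1⟩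
    · exact fun k hk τ hτ => (wp_trySwap hx (by omega) hτ).mono le_rfl fun υ hυ => hυ.next
    · exact fun τ hτ => ⟨hτ.1, hτ.2.1, hτ.2.2.1, hτ.2.2.2.2.2.nextElem⟩

theorem wp_searchSwap {σ : State n} (hg : I.GlobalRegs ε u v O σ) (hr : I.RunRegs Y σ)
    (hs : I.SolutionRegs S σ) (h1 : σ.set 1 = S) :
    Wp I searchSwap (n * ((n + 1) * 25 + 6) + 5) (fun τ => I.SearchRegs ε u v O Y S τ ∧
      τ.set 1 = S ∧ I.BestSwap ε Y S n 0 (τ.real 5) (τ.real 6) (τ.nat 5) (τ.nat 6)) σ := by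
  refine (wp_block (T := n * ((n + 1) * 25 + 6) + 2) ((wp_forUpto (N := n)
    (T := (n + 1) * 25 + 4) (Inv := fun k τ => I.ElemInv ε u v O Y S k k τ) ?_ ?_ ?_).mono le_rfl
    ?_)).mono (by simp; omega) fun _ h => h
  · simp only [applyAll, List.foldl_cons, List.foldl_nil]
    refine ⟨⟨hg.congr (by simp) (by simp) rfl, hr.congr (by simp) rfl,
      hs.congr (by simp) (by simp), ?_⟩, h1, by simp, ?_⟩
    · simp [hg.2.1.2.1, hs.1]
    · simpa using BestSwap.init I ε Y S _ _
  · exact fun k τ hτ => ⟨hτ.2.2.1, hτ.1.1.1.1⟩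
  · intro k hk τ hτ
    refine (wp_tryElem (x := ⟨k, hk⟩) hτ).mono le_rfl ?_
    rintro υ ⟨g1, g2, g3, g4⟩
    exact ⟨g1.congr (by simp) (by simp) rfl rfl, g2, by simp [g3], by simpa using g4⟩
  · exact fun τ hτ => ⟨hτ.1, hτ.2.1, hτ.2.2.2⟩

end Problem

/-! ### The whole program -/

/-- Make one greedy swap, or set number register `7` to `0` at the end of the run. -/
def swapProg : Prog :=
  block [.askValue 1 1] <| .branch (.realLt 13 1) (block [.natConst 7 0] .skip) <|
    .seq searchSwap <| block [.realConst 8 0] <| .branch (.realLt 8 5)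
      (block [.dropElem 1 6, .putElem 1 5, .readSize 8 6, .realSub 3 3 8, .realAdd 3 3 6] .skip)
      (block [.natConst 7 0] .skip)

/-- The run that starts from the guess in the set registers `1` and `2`. -/
def runProg : Prog :=
  block [.askValue 2 1, .realMul 13 16 2, .natConst 7 1] (.loop (.natLt 9 7) swapProg)

/-- Make the set registers `1` and `2` empty. -/
def clearProg : Prog := forUpto 8 0 (block [.dropElem 1 8, .dropElem 2 8] .skip)

/-- Copy set register `1` to set register `0`. -/
def copyProg : Prog :=
  forUpto 8 0 (.branch (.mem 1 8) (block [.putElem 0 8] .skip) (block [.dropElem 0 8] .skip))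

/-- Treat the guess that consists of the elements with the numbers in the number registers `1` and
`2`. If they are equal, the candidate is this singleton itself. -/
def guessProg : Prog :=
  .seq clearProg <| block [.putElem 1 1, .putElem 1 2, .putElem 2 1, .putElem 2 2, .readSize 3 1] <|
    .seq (.branch (.natEq 1 2) .skip (block [.readSize 7 2, .realAdd 3 3 7] .skip)) <|
    .branch (.indep 1) (.branch (.realLe 3 11) (.seq (.branch (.natEq 1 2) .skip runProg) <|
      block [.askValue 1 1] <| .branch (.realLt 0 1) (block [.realCopy 0 1] copyProg) .skip)
      .skip) .skip

/-- The modified algorithm. -/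
def mainProg (q : ℚ) : Prog :=
  block [.groundCard 0, .groundCard 10, .natSucc 10, .realConst 12 q, .realOfNat 14 0,
    .realMul 15 14 14, .realDiv 12 12 15, .realConst 15 1, .realAdd 12 15 12, .realConst 15 2,
    .realDiv 16 14 15, .readBound 11, .askValue 0 0] (forUpto 1 0 (forUpto 2 0 guessProg))

/-- The running time of `swapProg`. -/
def swapTime (n : ℕ) : ℕ := n * ((n + 1) * 25 + 6) + 14

/-- The running time of `runProg`. -/
noncomputable def runTime (ε : ℝ) (n : ℕ) : ℕ :=
  (Problem.maxSwaps ε n + 1) * (swapTime n + 1) + 4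

/-- The running time of `mainProg`. -/
noncomputable def mainTime (ε : ℝ) (n : ℕ) : ℕ :=
  n * (n * (runTime ε n + n * 8 + 20) + 4) + 15

theorem addElem_val {n : ℕ} (S : Finset (Fin n)) (x : Fin n) : addElem S x = insert x S := by
  simp [addElem]

/-! ### Correctness and running time of the whole program -/

namespace Problem

variable {n : ℕ} {I : Problem n} {ε : ℝ} {u v : ℕ} {O Y S : Finset (Fin n)}

theorem size_val (x : Fin n) : I.size x = I.c x := by simp [size]

/-- A swap is made only from an unrefuted set, so `ReachedIn.lt_maxSwaps` applies before it; this
bounds the loop of the run. -/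
theorem wp_swapProg (hε : 0 < ε) (hε' : ε ≤ 1) (hY : Y.card = 2) {σ : State n}
    (hg : I.GlobalRegs ε u v O σ) (hr : I.RunRegs Y σ) {m : ℕ} (hm : I.ReachedIn ε Y (σ.set 1) m)
    (h3 : σ.real 3 = I.cost (σ.set 1)) (h7 : σ.nat 7 = 1) :
    Wp I swapProg (swapTime n) (fun τ => (I.GlobalRegs ε u v O τ ∧ I.RunRegs Y τ) ∧
      (τ.nat 7 = 0 ∧ I.RunResult ε Y (τ.set 1) ∨ m < maxSwaps ε n ∧ τ.nat 7 = 1 ∧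
        I.ReachedIn ε Y (τ.set 1) (m + 1) ∧ τ.real 3 = I.cost (τ.set 1))) σ := by
  refine (wp_block (T := n * ((n + 1) * 25 + 6) + 13) (wp_branch (fun c => ?_) fun c => ?_)).mono
    (by simp [swapTime]; omega) fun _ h => h
  · refine (wp_block (T := 0) (wp_skip ?_)).mono (by simp) fun _ h => h
    simp only [applyAll, List.foldl_cons, List.foldl_nil]
    refine ⟨⟨hg.congr (by simp) (by simp) (by simp), hr.congr (by simp) (by simp)⟩,
      Or.inl ⟨by simp, hm.1, ?_⟩⟩
    intro S' hS'
    refine hS'.1 ?_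
    simpa [applyAll, Cond.Holds, Refutes, hr.2] using c
  · have hnr : ¬ I.Refutes (σ.set 1) Y := by
      simpa [applyAll, Cond.Holds, Refutes, hr.2] using c
    refine (wp_seq (T' := 7) ((wp_searchSwap (ε := ε) (S := σ.set 1) (u := u) (v := v) (O := O) (Y := Y)
      ?_ ?_ ?_ ?_).mono le_rfl ?_)).mono le_rfl fun _ h => h
    · exact hg.congr (by simp [applyAll]) (by simp [applyAll]) (by simp [applyAll])
    · exact hr.congr (by simp [applyAll]) (by simp [applyAll])
    · exact ⟨by simp [applyAll], by simp [applyAll, h3], by simp [applyAll, h7]⟩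
    · simp [applyAll]
    · rintro τ ⟨g1, g2, g3⟩
      refine (wp_block (T := 6) (wp_branch (fun c' => ?_) fun c' => ?_)).mono
        (by simp) fun _ h => h
      · have hpos : 0 < τ.real 5 := by simpa [applyAll, Cond.Holds] using c'
        obtain ⟨ha, hc, hsw, hgr⟩ := g3.greedySwap hpos
        have hmem : ∀ h : τ.nat 6 < n, (⟨τ.nat 6, h⟩ : Fin n) ∈ σ.set 1 := fun h =>
          hsw.2.1 _ (by simp [ofNumber, h])
        have hset : addElem (delElem (σ.set 1) (τ.nat 6)) (τ.nat 5) =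
            exchange (σ.set 1) ⟨τ.nat 5, ha⟩ (ofNumber n (τ.nat 6)) :=
          addElem_delElem (σ.set 1) ⟨τ.nat 5, ha⟩ (τ.nat 6)
        have hcost := cost_sub_size_add (I := I) hsw.1 hmem
        refine (wp_block (T := 0) (wp_skip ?_)).mono (by simp) fun _ h => h
        simp only [applyAll, List.foldl_cons, List.foldl_nil]
        refine ⟨⟨g1.1.congr (by simp) (by simp) (by simp), g1.2.1.congr (by simp) (by simp)⟩,
          Or.inr ⟨hm.lt_maxSwaps hε hε' hY hnr, by simp [g1.2.2.1.2.2], ?_, ?_⟩⟩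
        · simpa [g2, hset] using hm.step hε.le ⟨hnr, hgr⟩
        · simp [g2, hset, ← hcost, g1.2.2.1.2.1, hc]
      · have hpos : ¬ 0 < τ.real 5 := by simpa [applyAll, Cond.Holds] using c'
        refine (wp_block (T := 0) (wp_skip ?_)).mono (by simp) fun _ h => h
        simp only [applyAll, List.foldl_cons, List.foldl_nil]
        refine ⟨⟨g1.1.congr (by simp) (by simp) (by simp), g1.2.1.congr (by simp) (by simp)⟩,
          Or.inl ⟨by simp, ?_⟩⟩
        have : I.RunResult ε Y (σ.set 1) := by
          refine ⟨hm.1, ?_⟩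
          rintro S' ⟨-, x, y, hacc, -⟩
          exact g3.not_acceptable hpos x y hacc
        simpa [g2] using this

theorem wp_runProg (hε : 0 < ε) (hε' : ε ≤ 1) (hY : Y.card = 2) {σ : State n}
    (hg : I.GlobalRegs ε u v O σ) (h1 : σ.set 1 = Y) (h2 : σ.set 2 = Y)
    (h3 : σ.real 3 = I.cost Y) :
    Wp I runProg (runTime ε n)
      (fun τ => I.GlobalRegs ε u v O τ ∧ I.RunResult ε Y (τ.set 1)) σ := by
  -- One round beyond `maxSwaps` is needed to detect the end of the run.
  refine (wp_block ((wp_loop (K := maxSwaps ε n + 1) (T := swapTime n)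
    (Inv := fun k τ => (I.GlobalRegs ε u v O τ ∧ I.RunRegs Y τ) ∧
      (τ.nat 7 = 0 ∧ I.RunResult ε Y (τ.set 1) ∨ ∃ m ≤ maxSwaps ε n, m + k = maxSwaps ε n + 1 ∧
        τ.nat 7 = 1 ∧ I.ReachedIn ε Y (τ.set 1) m ∧ τ.real 3 = I.cost (τ.set 1))) ?_ ?_).mono
    le_rfl ?_)).mono (by simp [runTime]; omega) fun _ h => h
  · simp only [applyAll, List.foldl_cons, List.foldl_nil]
    refine ⟨⟨hg.congr (by simp) (by simp) (by simp), ?_, ?_⟩, Or.inr ⟨0, by omega, by omega,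
      by simp, by simpa [h1] using I.reachedIn_zero ε Y, by simp [h1, h3]⟩⟩
    · simp [h2]
    · simp [h1, hg.2.1.2.2]
  · rintro k τ ⟨⟨g1, g2⟩, ⟨g3, -⟩ | ⟨m, hm, hmk, g3, g4, g5⟩⟩ hb
    · have : τ.nat 9 < τ.nat 7 := hb
      omega
    · refine ⟨k - 1, by omega, ?_⟩
      refine (wp_swapProg hε hε' hY g1 g2 g4 g5 g3).mono le_rfl ?_
      rintro υ ⟨e1, e2 | ⟨e2, e3, e4, e5⟩⟩
      · exact ⟨e1, Or.inl e2⟩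
      · exact ⟨e1, Or.inr ⟨m + 1, by omega, by omega, e3, e4, e5⟩⟩
  · rintro τ ⟨hb, k, ⟨g1, g2⟩, ⟨-, g3⟩ | ⟨m, -, -, g3, -⟩⟩
    · exact ⟨g1, g3⟩
    · refine absurd ?_ hb
      have : τ.nat 9 = 0 := g1.1.2.1
      change τ.nat 9 < τ.nat 7
      omega

theorem wp_clearProg {σ : State n} (hg : I.GlobalRegs ε u v O σ) :
    Wp I clearProg (n * 4 + 2)
      (fun τ => I.GlobalRegs ε u v O τ ∧ τ.set 1 = ∅ ∧ τ.set 2 = ∅) σ := by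
  refine (wp_forUpto (N := n) (T := 2) (Inv := fun k τ => I.GlobalRegs ε u v O τ ∧ τ.nat 8 = k ∧
    (∀ z ∈ τ.set 1, k ≤ z.val) ∧ ∀ z ∈ τ.set 2, k ≤ z.val) ?_ ?_ ?_).mono le_rfl ?_
  · exact ⟨hg.congr (by simp) (by simp) rfl, by simp, by simp, by simp⟩
  · exact fun k τ hτ => ⟨hτ.2.1, hτ.1.1.1⟩
  · rintro k hk τ ⟨g1, g2, g3, g4⟩
    have hdel : ∀ A : Finset (Fin n), (∀ z ∈ A, k ≤ z.val) → ∀ z ∈ delElem A k, k + 1 ≤ z.val := by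
      intro A hA z hz
      simp only [delElem, hk, dif_pos, Finset.mem_erase, ne_eq, Fin.ext_iff] at hz
      have := hA z hz.2
      omega
    refine wp_block (T := 0) (wp_skip ?_)
    simp only [applyAll, List.foldl_cons, List.foldl_nil]
    refine ⟨g1.congr (by simp) (by simp) (by simp), by simp [g2], ?_, ?_⟩
    · simpa [g2] using hdel _ g3
    · simpa [g2] using hdel _ g4
  · rintro τ ⟨g1, -, g3, g4⟩
    refine ⟨g1, Finset.eq_empty_of_forall_notMem fun z hz => ?_,
      Finset.eq_empty_of_forall_notMem fun z hz => ?_⟩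
    · have := g3 z hz
      omega
    · have := g4 z hz
      omega

/-- While copying, set register 0 holds a mixture of two sets, so the global invariant is stated for
the state in which this register is replaced by S. -/
theorem wp_copyProg {σ : State n} (hg : I.GlobalRegs ε u v S (σ.setSet 0 S))
    (h1 : σ.set 1 = S) :
    Wp I copyProg (n * 4 + 2) (I.GlobalRegs ε u v S) σ := by
  refine (wp_forUpto (N := n) (T := 2) (Inv := fun k τ =>
    I.GlobalRegs ε u v S (τ.setSet 0 S) ∧ τ.set 1 = S ∧ τ.nat 8 = k ∧
      ∀ z : Fin n, z.val < k → (z ∈ τ.set 0 ↔ z ∈ S)) ?_ ?_ ?_).mono le_rfl ?_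
  · exact ⟨hg.congr (by simp) (by simp) (by simp), by simp [h1], by simp, fun z hz => by omega⟩
  · exact fun k τ hτ => ⟨hτ.2.2.1, hτ.1.1.1⟩
  · rintro k hk τ ⟨g1, g2, g3, g4⟩
    refine wp_branch (fun c => ?_) fun c => ?_
    · obtain ⟨e, he⟩ := c
      simp only [g2, g3] at he
      refine wp_block (T := 0) (wp_skip ?_)
      simp only [applyAll, List.foldl_cons, List.foldl_nil]
      refine ⟨g1.congr (by simp) (by simp) (by simp), by simp [g2], by simp [g3], ?_⟩
      intro z hz
      by_cases hzk : z = ⟨k, hk⟩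
      · subst hzk
        simp [g3, addElem, hk, he]
      · have hlt : z.val < k := by
          have : z.val ≠ k := fun h => hzk (Fin.ext h)
          omega
        simp [g3, addElem, hk, hzk, g4 z hlt]
    · have he : (⟨k, hk⟩ : Fin n) ∉ S := by
        intro he
        refine c ⟨by rw [g3]; exact hk, ?_⟩
        simp only [g2, g3]
        exact he
      refine wp_block (T := 0) (wp_skip ?_)
      simp only [applyAll, List.foldl_cons, List.foldl_nil]
      refine ⟨g1.congr (by simp) (by simp) (by simp), by simp [g2], by simp [g3], ?_⟩
      intro z hz
      by_cases hzk : z = ⟨k, hk⟩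
      · subst hzk
        simp [g3, delElem, hk, he]
      · have hlt : z.val < k := by
          have : z.val ≠ k := fun h => hzk (Fin.ext h)
          omega
        simp [g3, delElem, hk, hzk, g4 z hlt]
  · rintro τ ⟨g1, g2, g3, g4⟩
    have : τ.set 0 = S := Finset.ext fun z => g4 z z.2
    rw [← this] at g1
    rw [State.setSet_self] at g1
    rwa [this] at g1

/-- `R` is a possible result for the guess `{b, a}`. -/
def GuessResult (I : Problem n) (ε : ℝ) (a b : Fin n) (R : Finset (Fin n)) : Prop :=
  if a = b then R = {a} else I.RunResult ε {b, a} R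

/-- `O` is a best solution found with the guesses up to those with first element `u` and one of
the first `v` elements. -/
def BestSolution (I : Problem n) (ε : ℝ) (u v : ℕ) (O : Finset (Fin n)) : Prop :=
  I.f ∅ ≤ I.f O ∧
  (∀ a b : Fin n, (a.val < u ∨ a.val = u ∧ b.val < v) → I.Feasible {b, a} →
    ∃ R, I.GuessResult ε a b R ∧ I.f R ≤ I.f O) ∧
  (O = ∅ ∨ ∃ a b, I.Feasible {b, a} ∧ I.GuessResult ε a b O)

theorem BestSolution.next {a b : Fin n} {O' : Finset (Fin n)} (h : I.BestSolution ε a b O)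
    (hle : I.f O ≤ I.f O') (hO' : O' = O ∨ I.Feasible {b, a} ∧ I.GuessResult ε a b O')
    (hab : I.Feasible {b, a} → ∃ R, I.GuessResult ε a b R ∧ I.f R ≤ I.f O') :
    I.BestSolution ε a (b + 1) O' := by
  refine ⟨h.1.trans hle, fun a' b' h' hf => ?_, ?_⟩
  · by_cases hlt : a'.val < a.val ∨ a'.val = a.val ∧ b'.val < b.val
    · obtain ⟨R, h1, h2⟩ := h.2.1 a' b' hlt hf
      exact ⟨R, h1, h2.trans hle⟩
    · obtain rfl : a' = a := Fin.ext (by omega)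
      obtain rfl : b' = b := Fin.ext (by omega)
      exact hab hf
  · rcases hO' with rfl | hO'
    · exact h.2.2
    · exact Or.inr ⟨a, b, hO'⟩

theorem cost_pair {a b : Fin n} (hab : a ≠ b) : I.cost {b, a} = I.c a + I.c b := by
  rw [cost, Finset.sum_pair hab.symm, add_comm]

theorem wp_guessProg (hε : 0 < ε) (hε' : ε ≤ 1) {a b : Fin n} {σ : State n}
    (hg : I.GlobalRegs ε a b O σ) (hO : I.BestSolution ε a b O) :
    Wp I guessProg (runTime ε n + n * 8 + 18)
      (fun τ => ∃ O', I.GlobalRegs ε a b O' τ ∧ I.BestSolution ε a (b + 1) O') σ := by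
  refine (wp_seq (T' := runTime ε n + n * 4 + 16) ((wp_clearProg hg).mono le_rfl ?_)).mono
    (by omega) fun _ h => h
  rintro τ ⟨g1, g2, g3⟩
  refine (wp_block (T := runTime ε n + n * 4 + 11)
    ((wp_seq (T := 3) (T' := runTime ε n + n * 4 + 8) ?_).mono (by omega) fun _ h => h)).mono
    (by simp; omega) fun _ h => h
  set τ' := applyAll I [.putElem 1 1, .putElem 1 2, .putElem 2 1, .putElem 2 2, .readSize 3 1] τ
    with hτ'
  have n1 : τ.nat 1 = a := g1.1.2.2.2.1
  have n2 : τ.nat 2 = b := g1.1.2.2.2.2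
  have e1 : τ'.set 1 = {b, a} := by simp [hτ', applyAll, g2, n1, n2, addElem_val]
  have e2 : τ'.set 2 = {b, a} := by simp [hτ', applyAll, g3, n1, n2, addElem_val]
  have e3 : τ'.real 3 = I.c a := by simp [hτ', applyAll, n1, size_val]
  have e4 : I.GlobalRegs ε a b O τ' := g1.congr (by simp [hτ', applyAll])
    (by simp [hτ', applyAll]) (by simp [hτ', applyAll])
  clear_value τ'
  have hcost : Wp I (.branch (.natEq 1 2) .skip (block [.readSize 7 2, .realAdd 3 3 7] .skip)) 3
      (fun υ => I.GlobalRegs ε a b O υ ∧ υ.set 1 = {b, a} ∧ υ.set 2 = {b, a} ∧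
        υ.real 3 = I.cost {b, a}) τ' := by
    have hiff : (Cond.natEq 1 2).Holds I τ' ↔ a = b := by
      change τ'.nat 1 = τ'.nat 2 ↔ a = b
      rw [e4.1.2.2.2.1, e4.1.2.2.2.2, Fin.ext_iff]
    refine wp_branch (fun c => wp_skip ⟨e4, e1, e2, ?_⟩) fun c => ?_
    · rw [hiff] at c
      subst c
      simp [e3, cost]
    · rw [hiff] at c
      refine wp_block (T := 0) (wp_skip ?_)
      simp only [applyAll, List.foldl_cons, List.foldl_nil]
      refine ⟨e4.congr (by simp) (by simp) rfl, by simp [e1], by simp [e2], ?_⟩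
      simp [cost_pair c, e3, e4.1.2.2.2.2, size_val]
  refine hcost.mono le_rfl ?_
  rintro υ ⟨k1, k2, k3, k4⟩
  have hno : ¬ I.Feasible {b, a} →
      ∃ O', I.GlobalRegs ε a b O' υ ∧ I.BestSolution ε a (b + 1) O' := fun hf =>
    ⟨O, k1, hO.next le_rfl (Or.inl rfl) fun h => absurd h hf⟩
  refine wp_branch (T := runTime ε n + n * 4 + 7) (fun c1 => wp_branch (T := runTime ε n + n * 4 + 6)
    (fun c2 => ?_) fun c2 => wp_skip (hno ?_)) fun c1 => wp_skip (hno ?_)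
  · have hf : I.Feasible {b, a} := by
      refine ⟨?_, ?_⟩
      · rw [← k2]
        exact c1
      · rw [← k4, ← k1.2.1.1]
        exact c2
    have hiff : (Cond.natEq 1 2).Holds I υ ↔ a = b := by
      change υ.nat 1 = υ.nat 2 ↔ a = b
      rw [k1.1.2.2.2.1, k1.1.2.2.2.2, Fin.ext_iff]
    have hrun : Wp I (.branch (.natEq 1 2) .skip runProg) (runTime ε n + 1)
        (fun ω => I.GlobalRegs ε a b O ω ∧ I.GuessResult ε a b (ω.set 1)) υ := by
      refine wp_branch (fun c => wp_skip ⟨k1, ?_⟩) fun c => ?_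
      · rw [hiff] at c
        subst c
        simp [GuessResult, k2]
      · rw [hiff] at c
        refine (wp_runProg hε hε' (Finset.card_pair (Ne.symm c)) k1 k2 k3 k4).mono le_rfl ?_
        rintro ω ⟨m1, m2⟩
        exact ⟨m1, by simpa [GuessResult, c] using m2⟩
    refine (wp_seq (T' := n * 4 + 5) (hrun.mono le_rfl ?_)).mono (by omega) fun _ h => h
    rintro ω ⟨m1, m2⟩
    refine (wp_block (T := n * 4 + 4) (wp_branch (fun c => ?_) fun c => wp_skip ?_)).mono
      (by simp; omega) fun _ h => h
    · have hlt : I.f O < I.f (ω.set 1) := by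
        simpa [applyAll, Cond.Holds, m1.2.2.1] using c
      refine (wp_block (T := n * 4 + 2) ((wp_copyProg (u := a) (v := b) (ε := ε)
        (S := ω.set 1) ?_ ?_).mono le_rfl ?_)).mono (by simp; omega) fun _ h => h
      · simp only [applyAll, List.foldl_cons, List.foldl_nil]
        obtain ⟨l1, l2, l3⟩ := m1
        exact ⟨by simpa using l1, by simpa using l2, by simp, by simp⟩
      · simp [applyAll]
      · intro χ hχ
        exact ⟨ω.set 1, hχ, hO.next hlt.le (Or.inr ⟨hf, m2⟩) fun _ => ⟨_, m2, le_rfl⟩⟩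
    · have hle : I.f (ω.set 1) ≤ I.f O := by
        simpa [applyAll, Cond.Holds, m1.2.2.1] using c
      refine ⟨O, m1.congr ?_ ?_ ?_, hO.next le_rfl (Or.inl rfl) fun _ => ⟨_, m2, hle⟩⟩
      · simp [applyAll]
      · simp [applyAll]
      · simp [applyAll]
  · intro hf
    apply c2
    change υ.real 3 ≤ υ.real 11
    rw [k4, k1.2.1.1]
    exact hf.2
  · intro hf
    apply c1
    change I.Indep (υ.set 1)
    rw [k2]
    exact hf.1

theorem GlobalRegs.setSecond {σ : State n} (hg : I.GlobalRegs ε u v O σ) (w : ℕ) :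
    I.GlobalRegs ε u w O (σ.setNat 2 w) :=
  ⟨⟨by simpa using hg.1.1, by simpa using hg.1.2.1, by simpa using hg.1.2.2.1,
    by simpa using hg.1.2.2.2.1, by simp⟩, hg.2⟩

theorem GlobalRegs.setFirst {σ : State n} (hg : I.GlobalRegs ε u v O σ) (w : ℕ) :
    I.GlobalRegs ε w v O (σ.setNat 1 w) :=
  ⟨⟨by simpa using hg.1.1, by simpa using hg.1.2.1, by simpa using hg.1.2.2.1, by simp,
    by simpa using hg.1.2.2.2.2⟩, hg.2⟩

theorem wp_mainProg {q : ℚ} (hε : 0 < (q : ℝ)) (hε' : (q : ℝ) ≤ 1) :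
    Wp I (mainProg q) (mainTime q n) (fun τ => I.BestSolution q n 0 (τ.set 0)) (State.init n) := by
  refine (wp_block (T := n * (n * (runTime q n + n * 8 + 20) + 4) + 2)
    ((wp_forUpto (N := n) (T := n * (runTime q n + n * 8 + 20) + 2) (Inv := fun u τ =>
      ∃ O v, I.GlobalRegs q u v O τ ∧ I.BestSolution q u 0 O) ?_ ?_ ?_).mono
      le_rfl ?_)).mono (by simp [mainTime]; omega) fun _ h => h
  · refine ⟨∅, 0, ⟨⟨?_, ?_, ?_, ?_, ?_⟩, ⟨?_, ?_, ?_⟩, ?_, ?_⟩, le_rfl, fun a b h => by omega,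
      Or.inl rfl⟩ <;> simp [applyAll, State.init]
    ring
  · rintro u τ ⟨O, v, h, -⟩
    exact ⟨h.1.2.2.2.1, h.1.1⟩
  · rintro u hu τ ⟨O, v, hg, hO⟩
    refine (wp_forUpto (N := n) (T := runTime q n + n * 8 + 18) (Inv := fun v τ =>
      ∃ O, I.GlobalRegs q u v O τ ∧ I.BestSolution q u v O) ?_ ?_ ?_).mono le_rfl ?_
    · exact ⟨O, hg.setSecond 0, hO⟩
    · rintro v τ ⟨O, h, -⟩
      exact ⟨h.1.2.2.2.2, h.1.1⟩
    · rintro v hv τ ⟨O, hg, hO⟩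
      refine (wp_guessProg (a := ⟨u, hu⟩) (b := ⟨v, hv⟩) hε hε' hg hO).mono le_rfl ?_
      rintro υ ⟨O', h1, h2⟩
      refine ⟨O', ?_, h2⟩
      rw [h1.1.2.2.2.2]
      exact h1.setSecond (v + 1)
    · rintro υ ⟨O', h1, h2⟩
      refine ⟨O', n, ?_, h2.1, fun a b h => h2.2.1 a b (by omega), h2.2.2⟩
      rw [h1.1.2.2.2.1]
      exact h1.setFirst (u + 1)
  · rintro τ ⟨O, v, hg, hO⟩
    rw [hg.2.2.2]
    exact hO

/-- `Output` wants one result per pair, whereas each pair was treated in both orders. Choosing S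
wherever it is a possible result makes S one of the chosen results; for the other pairs a recorded
result of value at most f(S) is taken. The diagonal guesses supply the singletons. -/
theorem BestSolution.output (h : I.BestSolution ε n 0 S) : I.Output ε S := by
  classical
  have hres : ∀ Y : Finset (Fin n), Y.card = 2 → I.Feasible Y →
      ∃ R, I.RunResult ε Y R ∧ I.f R ≤ I.f S := by
    intro Y hY hYf
    obtain ⟨b, a, hab, rfl⟩ := Finset.card_eq_two.1 hY
    obtain ⟨R, h1, h2⟩ := h.2.1 a b (Or.inl a.2) hYf
    rw [GuessResult, if_neg (Ne.symm hab)] at h1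
    exact ⟨R, h1, h2⟩
  refine ⟨fun Y => if hY : I.RunResult ε Y S then S else
    if hY : Y.card = 2 ∧ I.Feasible Y then (hres Y hY.1 hY.2).choose else ∅, ?_, ?_, ?_, ?_⟩
  · intro Y hY hYf
    by_cases hYS : I.RunResult ε Y S
    · simp [hYS]
    · simpa [hYS, hY, hYf] using (hres Y hY hYf).choose_spec.1
  · rcases h.2.2 with rfl | ⟨a, b, hf, hr⟩
    · refine Or.inl ⟨by simp, ?_, ?_⟩
      · simp [Indep]
      · simp [cost, I.B_nonneg]
    · by_cases hab : a = b
      · subst hab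
        rw [GuessResult, if_pos rfl] at hr
        subst hr
        exact Or.inl ⟨by simp, by simpa using hf⟩
      · rw [GuessResult, if_neg hab] at hr
        exact Or.inr ⟨{b, a}, Finset.card_pair (Ne.symm hab), hf, by simp [hr]⟩
  · intro T hT hTf
    rcases Nat.lt_or_ge T.card 1 with hc | hc
    · obtain rfl : T = ∅ := Finset.card_eq_zero.1 (by omega)
      exact h.1
    · obtain ⟨a, rfl⟩ := Finset.card_eq_one.1 (le_antisymm hT hc)
      obtain ⟨R, h1, h2⟩ := h.2.1 a a (Or.inl a.2) (by simpa using hTf)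
      rw [GuessResult, if_pos rfl] at h1
      rwa [h1] at h2
  · intro Y hY hYf
    by_cases hYS : I.RunResult ε Y S
    · simp [hYS]
    · simpa [hYS, hY, hYf] using (hres Y hY hYf).choose_spec.2

end Problem

/-- The running time of the modified algorithm is `O(n ^ 6 log n)`. -/
theorem exists_mainTime_le {ε : ℝ} (hε : 0 < ε) :
    ∃ C : ℝ, ∀ n : ℕ, (mainTime ε n : ℝ) ≤ C * ((n : ℝ) ^ 6 * Real.log n ^ 1 + 1) := by
  have hbig : ∀ n : ℕ, 2 ≤ n →
      (mainTime ε n : ℝ) ≤ 2000 * (4 + 2 / ε) * ((n : ℝ) ^ 6 * Real.log n) := by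
    intro n hn
    have hx : (2 : ℝ) ≤ n := by exact_mod_cast hn
    have hl : 1 / 2 ≤ Real.log n := by
      have h1 : Real.log 2 ≤ Real.log n := Real.log_le_log two_pos hx
      linarith [Real.log_two_gt_d9]
    have hfl : (⌊2 * (n : ℝ) ^ 2 / ε * Real.log n⌋₊ : ℝ) ≤ 2 * (n : ℝ) ^ 2 / ε * Real.log n :=
      Nat.floor_le (by positivity)
    unfold mainTime runTime swapTime Problem.maxSwaps
    push_cast
    set x : ℝ := (n : ℝ)
    set l := Real.log x
    set F : ℝ := (⌊2 * x ^ 2 / ε * l⌋₊ : ℝ)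
    have hx0 : 0 < x := by linarith
    have hx2 : 2 * x ≤ x ^ 2 := by nlinarith
    have hxl : x ^ 2 ≤ 2 * (x ^ 2 * l) := by nlinarith [sq_nonneg x]
    have hK : x + F + 1 + 1 ≤ (4 + 2 / ε) * (x ^ 2 * l) := by
      have : 2 * x ^ 2 / ε * l = 2 / ε * (x ^ 2 * l) := by ring
      nlinarith
    have hD : x * ((x + 1) * 25 + 6) + 14 + 1 ≤ 50 * x ^ 2 := by nlinarith
    have hF : 0 ≤ F := Nat.cast_nonneg _
    have hprod : (x + F + 1 + 1) * (x * ((x + 1) * 25 + 6) + 14 + 1) ≤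
        (4 + 2 / ε) * (x ^ 2 * l) * (50 * x ^ 2) :=
      mul_le_mul hK hD (by positivity) (by positivity)
    -- A bounds the rounds of a run times the cost of a round. The remaining terms are absorbed
    -- using x ≥ 2 and log x ≥ 1/2.
    set A := (4 + 2 / ε) * (x ^ 2 * l) * (50 * x ^ 2) with hA
    have hA4 : 100 * x ^ 4 ≤ A := by
      have h1 : 4 ≤ 4 + 2 / ε := by
        have : 0 ≤ 2 / ε := by positivity
        linarith
      have h2 : 4 * (x ^ 2 / 2) ≤ (4 + 2 / ε) * (x ^ 2 * l) :=
        mul_le_mul h1 (by linarith) (by positivity) (by positivity)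
      have h3 := mul_le_mul_of_nonneg_right h2 (by positivity : 0 ≤ 50 * x ^ 2)
      rw [hA]
      refine le_trans (le_of_eq ?_) h3
      ring
    have hx4 : 4 * x ^ 2 ≤ x ^ 4 := by nlinarith [sq_nonneg x]
    have hA0 : 0 ≤ A := by positivity
    have hR : (x + F + 1 + 1) * (x * ((x + 1) * 25 + 6) + 14 + 1) + 4 + x * 8 + 20 ≤ 2 * A := by
      nlinarith
    have h5 := mul_le_mul_of_nonneg_left hR hx0.le
    have h6 : x * (2 * A) + 4 ≤ x * (3 * A) := by nlinarith
    have h7 : x * (x * ((x + F + 1 + 1) * (x * ((x + 1) * 25 + 6) + 14 + 1) + 4 + x * 8 + 20) + 4)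
        ≤ x * (x * (3 * A)) := mul_le_mul_of_nonneg_left (by linarith) hx0.le
    have h8 : 15 ≤ x * (x * A) := by nlinarith
    have h9 : x * (x * (4 * A)) = 200 * (4 + 2 / ε) * (x ^ 6 * l) := by
      rw [hA]
      ring
    have h10 : 0 ≤ (4 + 2 / ε) * (x ^ 6 * l) := by positivity
    nlinarith
  -- For n ≤ 1 the logarithm vanishes, so these two running times enter the constant and are covered
  -- by the summand 1.
  refine ⟨2000 * (4 + 2 / ε) + mainTime ε 0 + mainTime ε 1, fun n => ?_⟩
  have h0 : (0 : ℝ) ≤ mainTime ε 0 := Nat.cast_nonneg _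
  have h1 : (0 : ℝ) ≤ mainTime ε 1 := Nat.cast_nonneg _
  have h2 : 0 ≤ 2000 * (4 + 2 / ε) := by positivity
  have hlog := Real.log_natCast_nonneg n
  have hP : 0 ≤ (n : ℝ) ^ 6 * Real.log n ^ 1 := by positivity
  rcases Nat.lt_or_ge n 2 with hn | hn
  · have hm : (mainTime ε n : ℝ) ≤ 2000 * (4 + 2 / ε) + mainTime ε 0 + mainTime ε 1 := by
      interval_cases n <;> linarith
    exact hm.trans (le_mul_of_one_le_right (by linarith) (by linarith))
  · refine (hbig n hn).trans ?_
    rw [pow_one] at hP ⊢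
    exact mul_le_mul (by linarith) (by linarith) hP (by linarith)

end MatKnap

/-- For a suitable constant `ε`, every output of the modified algorithm is a
`(1 - e ^ (-2)) / 2`-approximation, and the modified algorithm is carried out by a program whose
running time is `O(n ^ 6 (log n) ^ k)` for some `k`. -/
theorem theorem2 :
    ∃ ε : ℝ, 0 < ε ∧
      (∀ (n : ℕ) (I : MatKnap.Problem n) (S : Finset (Fin n)),
        I.Output ε S → I.IsApprox ((1 - Real.exp (-2)) / 2) S) ∧
      ∃ (p : MatKnap.Prog) (C : ℝ) (k : ℕ), ∀ (n : ℕ) (I : MatKnap.Problem n),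
        ∃ S, I.Output ε S ∧
          p.ComputesWithin I S (C * ((n : ℝ) ^ 6 * Real.log n ^ k + 1)) := by
  -- The program needs a rational ε, and 1/8 ≤ e^(-2) because e² ≤ 8.
  have hpos : (0 : ℝ) < ((1 / 8 : ℚ) : ℝ) := by norm_num
  have hexp : ((1 / 8 : ℚ) : ℝ) ≤ Real.exp (-2) := by
    rw [Real.exp_neg, show (2 : ℝ) = 1 + 1 by norm_num, Real.exp_add]
    have h1 := Real.exp_one_lt_d9
    have h2 := Real.exp_pos 1
    have h3 : Real.exp 1 * Real.exp 1 ≤ 8 := by nlinarith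
    have h4 := inv_anti₀ (by positivity) h3
    push_cast
    linarith
  obtain ⟨C, hC⟩ := MatKnap.exists_mainTime_le hpos
  refine ⟨((1 / 8 : ℚ) : ℝ), hpos, fun n I S hS => hS.isApprox hpos hexp,
    MatKnap.mainProg (1 / 8), C, 1, fun n I => ?_⟩
  obtain ⟨τ, t, h1, h2, h3⟩ := MatKnap.Problem.wp_mainProg (I := I) hpos (by norm_num)
  exact ⟨τ.set 0, h3.output, τ, t, h1, rfl, (Nat.cast_le.2 h2).trans (hC n)⟩
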